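/- **Theorem.** Let $N\ge 1$ be an integer and let $0<\lambda\le\Lambda$. For a real symmetric $N\times N$ matrix $A$ with eigenvalues $e_1,\dots,e_N$ (repeated according to multiplicity) let $$\mathcal M^+_{\lambda,\Lambda}(A)=\lambda\sum_{e_i<0}e_i+\Lambda\sum_{e_i\ge 0}e_i,\qquad \mathcal M^-_{\lambda,\Lambda}(A)=\Lambda\sum_{e_i<0}e_i+\lambda\sum_{e_i\ge 0}e_i .$$ Let $g:\mathbb R\to\mathbb R$ satisfy - (g1) $g$ is locally Lipschitz; - (g2) $g$ is odd; - (g3) there is $\alpha\in(0,+\infty]$ such that $g>0$ on $(0,\alpha)$ and $g<0$ on $(\alpha,+\infty)$; - (g4) if $N\ge 2$, then $g$ is differentiable at $0$ and $g'(0)>0$. Then, for each of the two operators $\mathcal M=\mathcal M^+_{\lambda,\Lambda}$ and $\mathcal M=\mathcal M^-_{\lambda,\Lambda}$, the equation $$\mathcal M(D^2u)+g(u)=0\quad\text{in }\mathbb R^N,$$ where $D^2u$ is the Hessian matrix of $u$, has infinitely many solutions $u\in C^2(\mathbb R^N)$ that are radially symmetric about the origin (that is, even if $N=1$) and oscillating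 (that is, $u$ has an unbounded sequence of zeros) and that moreover are periodic if $N=1$, and localized if $N\ge 2$ (that is, $u$ and all its partial derivatives of order one and two tend to $0$ at infinity). -/

import Mathlib

open Filter Topology

noncomputable section

namespace Pucci

/-- The Hessian matrix `D²u(x)` of `u : ℝ^N → ℝ`: its entry `(i, j)` is `∂ᵢ∂ⱼ u (x)`. -/
def hessian {N : ℕ} (u : EuclideanSpace ℝ (Fin N) → ℝ) (x : EuclideanSpace ℝ (Fin N)) :
    Matrix (Fin N) (Fin N) ℝ :=
  Matrix.of fun i j =>
    fderiv ℝ (fderiv ℝ u) x (EuclideanSpace.single i 1) (EuclideanSpace.single j 1)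

/-- The Pucci operator `M⁺(A) = lam * ∑_{e < 0} e + Lam * ∑_{e ≥ 0} e`, where `e` runs over the
eigenvalues of `A`, repeated according to multiplicity (the roots of the characteristic
polynomial; a symmetric matrix has `N` of them). -/
def pucciPlus {N : ℕ} (lam Lam : ℝ) (A : Matrix (Fin N) (Fin N) ℝ) : ℝ :=
  lam * (A.charpoly.roots.filter (fun e => e < 0)).sum +
    Lam * (A.charpoly.roots.filter (fun e => 0 ≤ e)).sum

/-- The Pucci operator `M⁻(A) = Lam * ∑_{e < 0} e + lam * ∑_{e ≥ 0} e`, where `e` runs over the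
eigenvalues of `A`, repeated according to multiplicity. -/
def pucciMinus {N : ℕ} (lam Lam : ℝ) (A : Matrix (Fin N) (Fin N) ℝ) : ℝ :=
  Lam * (A.charpoly.roots.filter (fun e => e < 0)).sum +
    lam * (A.charpoly.roots.filter (fun e => 0 ≤ e)).sum

/-- `u` is of class `C²` and solves `F(D²u) + g(u) = 0` at every point of `ℝ^N`. -/
def IsC2Solution {N : ℕ} (F : Matrix (Fin N) (Fin N) ℝ → ℝ) (g : ℝ → ℝ)
    (u : EuclideanSpace ℝ (Fin N) → ℝ) : Prop :=
  ContDiff ℝ 2 u ∧ ∀ x, F (hessian u x) + g (u x) = 0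

/-- `u` is oscillating: it has an unbounded sequence of zeros. -/
def IsOscillating {N : ℕ} (u : EuclideanSpace ℝ (Fin N) → ℝ) : Prop :=
  ∃ z : ℕ → EuclideanSpace ℝ (Fin N),
    (∀ n, u (z n) = 0) ∧ ¬ Bornology.IsBounded (Set.range z)

/-- `u` is radially symmetric about the origin (for `N = 1`: even). -/
def IsRadial {N : ℕ} (u : EuclideanSpace ℝ (Fin N) → ℝ) : Prop :=
  ∀ x y, ‖x‖ = ‖y‖ → u x = u y

/-- `u` has a nonzero period (used for `N = 1` only). -/
def IsPeriodic {N : ℕ} (u : EuclideanSpace ℝ (Fin N) → ℝ) : Prop :=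
  ∃ T : EuclideanSpace ℝ (Fin N), T ≠ 0 ∧ ∀ x, u (x + T) = u x

/-- `u` is localized: `u` and its partial derivatives of order one and two tend to zero at
infinity. -/
def IsLocalized {N : ℕ} (u : EuclideanSpace ℝ (Fin N) → ℝ) : Prop :=
  Tendsto u (cocompact _) (𝓝 0) ∧
    (∀ i, Tendsto (fun x => fderiv ℝ u x (EuclideanSpace.single i 1)) (cocompact _) (𝓝 0)) ∧
    ∀ i j, Tendsto (fun x => hessian u x i j) (cocompact _) (𝓝 0)

/-- There is `α ∈ (0, +∞]` such that `g` is positive on `(0, α)` and negative on `(α, +∞)`. -/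
def SignCondition (g : ℝ → ℝ) : Prop :=
  ∃ α : EReal, 0 < α ∧ (∀ t : ℝ, 0 < t → (t : EReal) < α → 0 < g t) ∧
    ∀ t : ℝ, α < (t : EReal) → g t < 0

end Pucci

end

/-!
A radial function `u(x) = v(|x|)` has the Hessian eigenvalues `v''`, once, and `v' / r`, `N - 1`
times. With `P = pucciFun a b`, the function of slope `a` on the positive and `b` on the negative
half-line, both equations read `P(v'') + (N - 1) P(v' / r) + g(v) = 0`, with `(a, b) = (Λ, λ)` for
`M⁺` and `(a, b) = (λ, Λ)` for `M⁻`. As `P` is invertible, this is `v'' = -F(v, v' / r)` with `F`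
increasing in its second variable (`radialForce`).

*Existence.* In terms of `z = v' / r` the singular initial value problem becomes a fixed point
equation which, for a globally Lipschitz `F`, is a contraction in a weighted sup norm on the whole
line (`exists_radial_profile`). To have `F` globally Lipschitz, `g` is replaced outside `[-M, M]`
by a linear continuation; the energy `(v')² / 2 + ∫₀ᵛ F(s, 0) ds` does not increase (`energy_le`),
so for small `v(0)` the solution stays in `[-M, M]` and the replacement is not felt.

*Oscillation.* While `v ≠ 0` the angle `arctan (v' / v)` decreases at a rate bounded below, which
cannot last (`exists_zero_ge`).

*Decay for `N ≥ 2`.* Here `F(v, v' / r) - F(v, 0)` is comparable to `v' / r`, and `g'(0) > 0`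
makes `F(v, 0)` comparable to `v`. A small multiple of `v v' / r` added to the energy turns it
into a functional that decays like a negative power of `r` (`tendsto_zero_of_damping`).

*Periodicity for `N = 1`.* The equation is autonomous, so solutions are symmetric about their
critical points, of which `0` is one and Rolle's theorem gives another
(`even_periodic_oscillating`).

Distinct small values of `v(0)` give distinct solutions.
-/

namespace Pucci

/-! ### Global radial profiles by one contraction -/

/-- The mean of `h` over the segment from `0` to `r` with weight `τ ^ k`,
`∫₀¹ τ ^ k h(r τ) dτ = r ^ (-k-1) ∫₀ʳ s ^ k h(s) ds`. The first form makes sense at `r = 0`. -/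
noncomputable def powMean (k : ℕ) (h : ℝ → ℝ) (r : ℝ) : ℝ :=
  ∫ τ in (0 : ℝ)..1, τ ^ k * h (r * τ)

theorem continuous_powMean (k : ℕ) {h : ℝ → ℝ} (hh : Continuous h) :
    Continuous (powMean k h) := by
  unfold powMean
  apply intervalIntegral.continuous_parametric_intervalIntegral_of_continuous' (by fun_prop)

theorem pow_mul_powMean (k : ℕ) (h : ℝ → ℝ) (r : ℝ) :
    r ^ (k + 1) * powMean k h r = ∫ s in (0 : ℝ)..r, s ^ k * h s := by
  have := intervalIntegral.mul_integral_comp_mul_left (a := 0) (b := 1)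
    (f := fun s => s ^ k * h s) r
  simp only [mul_zero, mul_one] at this
  rw [← this, pow_succ', mul_assoc, powMean, ← intervalIntegral.integral_const_mul]
  congr 1
  refine intervalIntegral.integral_congr fun τ _ => ?_
  simp only [mul_pow]
  ring

theorem powMean_zero (k : ℕ) (h : ℝ → ℝ) : powMean k h 0 = h 0 / (k + 1) := by
  simp [powMean, integral_pow]
  ring

theorem powMean_const (k : ℕ) (c r : ℝ) : powMean k (fun _ => c) r = c / (k + 1) := by
  simp [powMean, integral_pow]
  ring

theorem hasDerivAt_zero_mul {y : ℝ → ℝ} (hy : ContinuousAt y 0) :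
    HasDerivAt (fun r => r * y r) (y 0) 0 := by
  rw [hasDerivAt_iff_tendsto_slope]
  refine (hy.tendsto.mono_left nhdsWithin_le_nhds).congr' ?_
  filter_upwards [self_mem_nhdsWithin] with r hr
  have : r ≠ 0 := hr
  simp [slope_def_field, this]

/-- This includes `r = 0`, where the right-hand side is `h(0) / (k + 1)`. -/
theorem hasDerivAt_mul_powMean (k : ℕ) {h : ℝ → ℝ} (hh : Continuous h) (r : ℝ) :
    HasDerivAt (fun r => r * powMean k h r) (h r - k * powMean k h r) r := by
  rcases eq_or_ne r 0 with rfl | hr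
  · have := hasDerivAt_zero_mul (continuous_powMean k hh).continuousAt
    convert this using 1
    rw [powMean_zero]
    field_simp
    ring
  · have hI : HasDerivAt (fun r => ∫ s in (0 : ℝ)..r, s ^ k * h s) (r ^ k * h r) r :=
      ((continuous_pow k).mul hh).integral_hasStrictDerivAt 0 r |>.hasDerivAt
    have hd := hI.div (hasDerivAt_pow k r) (pow_ne_zero k hr)
    have heq : (fun r => r * powMean k h r) =ᶠ[𝓝 r]
        (fun r => ∫ s in (0 : ℝ)..r, s ^ k * h s) / fun r => r ^ k := by
      filter_upwards [isOpen_ne.mem_nhds hr] with t ht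
      have ht : t ≠ 0 := ht
      simp only [Pi.div_apply]
      rw [← pow_mul_powMean]
      field_simp
      ring
    refine (hd.congr_of_eventuallyEq heq).congr_deriv ?_
    rw [← pow_mul_powMean]
    rcases k with _ | k
    · simp
    · simp only [Nat.add_sub_cancel]
      field_simp
      ring

theorem abs_powMean_le (k : ℕ) {h B : ℝ → ℝ} (hB : Continuous B)
    (hhB : ∀ s, |h s| ≤ B s) (r : ℝ) : |powMean k h r| ≤ powMean k B r := by
  have hc : Continuous fun τ => τ ^ k * B (r * τ) := by fun_prop
  rw [← Real.norm_eq_abs]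
  unfold powMean
  refine intervalIntegral.norm_integral_le_of_norm_le zero_le_one ?_ (hc.intervalIntegrable _ _)
  refine Eventually.of_forall fun τ hτ => ?_
  rw [norm_mul, Real.norm_eq_abs, Real.norm_eq_abs, abs_of_nonneg (pow_nonneg hτ.1.le k)]
  exact mul_le_mul_of_nonneg_left (hhB _) (pow_nonneg hτ.1.le k)

theorem powMean_sub (k : ℕ) {h₁ h₂ : ℝ → ℝ} (h1 : Continuous h₁) (h2 : Continuous h₂) (r : ℝ) :
    powMean k h₁ r - powMean k h₂ r = powMean k (fun s => h₁ s - h₂ s) r := by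
  rw [powMean, powMean, ← intervalIntegral.integral_sub
    (Continuous.intervalIntegrable (by fun_prop) _ _)
    (Continuous.intervalIntegrable (by fun_prop) _ _)]
  simp [powMean, mul_sub]

theorem powMean_exp_le (k : ℕ) {K D : ℝ} (hK : 0 ≤ K) (hD : 0 ≤ D) (r : ℝ) :
    powMean k (fun s => D * Real.exp (K * s ^ 2)) r ≤ D * Real.exp (K * r ^ 2) / (k + 1) := by
  rw [← powMean_const k _ r]
  refine intervalIntegral.integral_mono_on zero_le_one
    (Continuous.intervalIntegrable (by fun_prop) _ _)
    (Continuous.intervalIntegrable (by fun_prop) _ _) fun τ hτ => ?_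
  have hτ2 : (r * τ) ^ 2 ≤ r ^ 2 := by
    rw [mul_pow]
    exact mul_le_of_le_one_right (sq_nonneg r) (pow_le_one₀ hτ.1 hτ.2)
  have := hτ.1
  have he : D * Real.exp (K * (r * τ) ^ 2) ≤ D * Real.exp (K * r ^ 2) := by gcongr
  exact mul_le_mul_of_nonneg_left he (pow_nonneg hτ.1 k)

theorem sq_mul_powMean_exp_le {K D : ℝ} (hK : 0 < K) (hD : 0 ≤ D) (r : ℝ) :
    r ^ 2 * powMean 1 (fun s => D * Real.exp (K * s ^ 2)) r
      ≤ D * Real.exp (K * r ^ 2) / (2 * K) := by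
  have hderiv : ∀ s ∈ Set.uIcc 0 r, HasDerivAt (fun s => D * Real.exp (K * s ^ 2) / (2 * K))
      (s ^ 1 * (D * Real.exp (K * s ^ 2))) s := by
    intro s _
    have := ((((hasDerivAt_pow 2 s).const_mul K).exp).const_mul D).div_const (2 * K)
    refine this.congr_deriv ?_
    field_simp
    norm_num
    ring
  rw [pow_mul_powMean 1, intervalIntegral.integral_eq_sub_of_hasDerivAt hderiv
    (Continuous.intervalIntegrable (by fun_prop) _ _)]
  have : 0 ≤ D * Real.exp (K * 0 ^ 2) / (2 * K) := by positivity
  linarith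

/-- The value at `r` of the solution of `v' = r z`, `v(0) = v₀`. -/
noncomputable def radialPrimitive (v₀ : ℝ) (z : ℝ → ℝ) (r : ℝ) : ℝ :=
  v₀ + r ^ 2 * powMean 1 z r

theorem continuous_radialPrimitive (v₀ : ℝ) {z : ℝ → ℝ} (hz : Continuous z) :
    Continuous (radialPrimitive v₀ z) := by
  have := continuous_powMean 1 hz
  unfold radialPrimitive
  fun_prop

theorem hasDerivAt_radialPrimitive (v₀ : ℝ) {z : ℝ → ℝ} (hz : Continuous z) (r : ℝ) :
    HasDerivAt (radialPrimitive v₀ z) (r * z r) r := by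
  have hI : HasDerivAt (fun r => ∫ s in (0 : ℝ)..r, s ^ 1 * z s) (r ^ 1 * z r) r :=
    ((continuous_pow 1).mul hz).integral_hasStrictDerivAt 0 r |>.hasDerivAt
  have h := hI.const_add v₀
  rw [pow_one] at h
  refine h.congr_of_eventuallyEq (Eventually.of_forall fun t => ?_)
  simp only [radialPrimitive]
  rw [pow_mul_powMean 1]

theorem abs_radialPrimitive_sub_le (v₀ : ℝ) {z₁ z₂ : ℝ → ℝ} (h1 : Continuous z₁)
    (h2 : Continuous z₂) {K D : ℝ} (hK : 0 < K) (hD : 0 ≤ D)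
    (h : ∀ s, |z₁ s - z₂ s| ≤ D * Real.exp (K * s ^ 2)) (r : ℝ) :
    |radialPrimitive v₀ z₁ r - radialPrimitive v₀ z₂ r| ≤ D * Real.exp (K * r ^ 2) / (2 * K) := by
  have : radialPrimitive v₀ z₁ r - radialPrimitive v₀ z₂ r =
      r ^ 2 * powMean 1 (fun s => z₁ s - z₂ s) r := by
    rw [← powMean_sub 1 h1 h2, radialPrimitive, radialPrimitive]
    ring
  rw [this, abs_mul, abs_of_nonneg (sq_nonneg r)]
  refine le_trans ?_ (sq_mul_powMean_exp_le hK hD r)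
  exact mul_le_mul_of_nonneg_left (abs_powMean_le 1 (by fun_prop) h r) (sq_nonneg r)

/-- For a function `H` that is Lipschitz with constant `n` in its second variable, the singular
initial value problem `v' = r z`, `(r z)' = H(v, z) - n z`, `v(0) = v₀` has a global solution.

It is equivalent to the fixed point equation `z = powMean n (H(v, z))`, in which the weight `τ ^ n`
gives the Lipschitz constant `n / (n + 1)` in `z`; the dependence on `v` is made
small by working with the norm `sup |z| exp(-K r²)`, `K` large. -/
theorem exists_radial_profile (n : ℕ) {H : ℝ → ℝ → ℝ} {L : ℝ} (hL : 0 ≤ L)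
    (hH : ∀ x z x' z', |H x z - H x' z'| ≤ L * |x - x'| + n * |z - z'|) (v₀ : ℝ) :
    ∃ v z : ℝ → ℝ, Continuous z ∧ v 0 = v₀ ∧ (∀ r, HasDerivAt v (r * z r) r) ∧
      ∀ r, HasDerivAt (fun r => r * z r) (H (v r) (z r) - n * z r) r := by
  have hHc : Continuous (fun q : ℝ × ℝ => H q.1 q.2) := by
    rw [continuous_iff_continuousAt]
    intro q
    have h0 : Tendsto (fun q' : ℝ × ℝ => L * |q'.1 - q.1| + n * |q'.2 - q.2|) (𝓝 q) (𝓝 0) := by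
      have : Continuous (fun q' : ℝ × ℝ => L * |q'.1 - q.1| + n * |q'.2 - q.2|) := by fun_prop
      simpa using this.tendsto q
    rw [ContinuousAt, tendsto_iff_dist_tendsto_zero]
    exact squeeze_zero (fun _ => dist_nonneg) (fun q' => hH _ _ _ _) h0
  set K : ℝ := L + 1 with hKdef
  have hK : 0 < K := by positivity
  -- `Z y` undoes the weight, `S y` is the right-hand side of the fixed point equation for `Z y`.
  let Z : (ℝ → ℝ) → ℝ → ℝ := fun y s => Real.exp (K * s ^ 2) * y s
  let S : (ℝ → ℝ) → ℝ → ℝ := fun y s => H (radialPrimitive v₀ (Z y) s) (Z y s)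
  let T : (ℝ → ℝ) → ℝ → ℝ := fun y r => Real.exp (-(K * r ^ 2)) * powMean n (S y) r
  have hZc : ∀ y, Continuous y → Continuous (Z y) := fun y hy => by fun_prop
  have hSc : ∀ y, Continuous y → Continuous (S y) := fun y hy =>
    hHc.comp ((continuous_radialPrimitive v₀ (hZc y hy)).prodMk (hZc y hy))
  have hTc : ∀ y, Continuous y → Continuous (T y) := fun y hy => by
    have := continuous_powMean n (hSc y hy)
    fun_prop
  set q : ℝ := (n + 1 / 2) / (n + 1) with hq
  have hq0 : 0 ≤ q := by positivity
  have hq1 : q < 1 := by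
    rw [hq, div_lt_one (by positivity)]
    linarith
  have hcontr : ∀ y₁ y₂ : ℝ → ℝ, Continuous y₁ → Continuous y₂ → ∀ D : ℝ, 0 ≤ D →
      (∀ s, |y₁ s - y₂ s| ≤ D) → ∀ r, |T y₁ r - T y₂ r| ≤ q * D := by
    intro y₁ y₂ h1 h2 D hD hy r
    have hZ : ∀ s, |Z y₁ s - Z y₂ s| ≤ D * Real.exp (K * s ^ 2) := by
      intro s
      simp only [Z]
      rw [← mul_sub, abs_mul, abs_of_pos (Real.exp_pos _), mul_comm]
      exact mul_le_mul_of_nonneg_right (hy s) (Real.exp_pos _).le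
    have hS : ∀ s, |S y₁ s - S y₂ s| ≤ ((n + 1 / 2) * D) * Real.exp (K * s ^ 2) := by
      intro s
      have e1 := hH (radialPrimitive v₀ (Z y₁) s) (Z y₁ s) (radialPrimitive v₀ (Z y₂) s) (Z y₂ s)
      have e2 := abs_radialPrimitive_sub_le v₀ (hZc _ h1) (hZc _ h2) hK hD hZ s
      have e3 : L * (D * Real.exp (K * s ^ 2) / (2 * K)) ≤ 1 / 2 * (D * Real.exp (K * s ^ 2)) := by
        have : L / (2 * K) ≤ 1 / 2 := by
          rw [div_le_iff₀ (by positivity)]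
          linarith
        calc L * (D * Real.exp (K * s ^ 2) / (2 * K))
            = L / (2 * K) * (D * Real.exp (K * s ^ 2)) := by
              ring
          _ ≤ _ := mul_le_mul_of_nonneg_right this (by positivity)
      have e4 := mul_le_mul_of_nonneg_left e2 hL
      have e5 := mul_le_mul_of_nonneg_left (hZ s) n.cast_nonneg
      simp only [S]
      linarith
    have hm : |powMean n (S y₁) r - powMean n (S y₂) r| ≤
        ((n + 1 / 2) * D) * Real.exp (K * r ^ 2) / (n + 1) := by
      rw [powMean_sub n (hSc _ h1) (hSc _ h2)]
      exact (abs_powMean_le n (by fun_prop) hS r).trans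
        (powMean_exp_le n hK.le (by positivity) r)
    simp only [T]
    rw [← mul_sub, abs_mul, abs_of_pos (Real.exp_pos _)]
    refine (mul_le_mul_of_nonneg_left hm (Real.exp_pos _).le).trans (le_of_eq ?_)
    rw [Real.exp_neg, hq]
    field_simp
  have hT0 : ∀ r, |T 0 r| ≤ |H v₀ 0| := by
    intro r
    have hS0 : S 0 = fun _ => H v₀ 0 := by
      funext s
      simp [S, Z, radialPrimitive, powMean]
    simp only [T]
    rw [hS0, powMean_const, abs_mul, abs_of_pos (Real.exp_pos _), abs_div,
      abs_of_pos (by positivity : (0 : ℝ) < n + 1)]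
    have h1 : Real.exp (-(K * r ^ 2)) ≤ 1 := Real.exp_le_one_iff.2 (by nlinarith [sq_nonneg r])
    have h2 : |H v₀ 0| / (n + 1) ≤ |H v₀ 0| := div_le_self (abs_nonneg _) (by simp)
    calc _ ≤ 1 * |H v₀ 0| := by gcongr
      _ = _ := one_mul _
  let Φ : BoundedContinuousFunction ℝ ℝ → BoundedContinuousFunction ℝ ℝ := fun y =>
    BoundedContinuousFunction.ofNormedAddCommGroup (T y) (hTc y y.continuous)
      (q * ‖y‖ + |H v₀ 0|) (fun r => by
        have h1 := hcontr y 0 y.continuous continuous_const ‖y‖ (norm_nonneg _)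
          (fun s => by simpa using y.norm_coe_le_norm s) r
        have h2 := hT0 r
        have h3 := abs_add_le (T y r - T 0 r) (T 0 r)
        rw [sub_add_cancel] at h3
        rw [Real.norm_eq_abs]
        linarith)
  have hΦ : ContractingWith ⟨q, hq0⟩ Φ := by
    refine ⟨by exact_mod_cast hq1, LipschitzWith.of_dist_le_mul fun y₁ y₂ => ?_⟩
    rw [BoundedContinuousFunction.dist_le (by positivity)]
    intro r
    exact hcontr y₁ y₂ y₁.continuous y₂.continuous _ dist_nonneg
      (fun s => BoundedContinuousFunction.dist_coe_le_dist (f := y₁) (g := y₂) s) r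
  set y := hΦ.fixedPoint with hy
  have hfix : Φ y = y := hΦ.fixedPoint_isFixedPt
  have hz : Z y = powMean n (S y) := by
    funext r
    have : y r = T y r := by
      conv_lhs => rw [← hfix]
      rfl
    simp only [Z]
    rw [this]
    simp only [T]
    rw [← mul_assoc, ← Real.exp_add]
    simp
  refine ⟨radialPrimitive v₀ (Z y), Z y, hZc y y.continuous, by simp [radialPrimitive],
    hasDerivAt_radialPrimitive v₀ (hZc y y.continuous), fun r => ?_⟩
  have h := hasDerivAt_mul_powMean n (hSc y y.continuous) r
  rw [← hz] at h
  exact h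

/-! ### Energy -/

/-- The primitive of `f` that vanishes at `0`. -/
noncomputable def potential (f : ℝ → ℝ) (x : ℝ) : ℝ := ∫ s in (0 : ℝ)..x, f s

theorem potential_zero (f : ℝ → ℝ) : potential f 0 = 0 := by simp [potential]

theorem hasDerivAt_potential {f : ℝ → ℝ} (hf : Continuous f) (x : ℝ) :
    HasDerivAt (potential f) (f x) x :=
  (hf.integral_hasStrictDerivAt 0 x).hasDerivAt

theorem continuous_potential {f : ℝ → ℝ} (hf : Continuous f) : Continuous (potential f) :=
  continuous_iff_continuousAt.2 fun x => (hasDerivAt_potential hf x).continuousAt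

theorem potential_strictMonoOn {f : ℝ → ℝ} (hf : Continuous f)
    (hpos : ∀ x, x ≠ 0 → 0 < x * f x) : StrictMonoOn (potential f) (Set.Ici 0) := by
  refine strictMonoOn_of_deriv_pos (convex_Ici 0) (continuous_potential hf).continuousOn ?_
  intro x hx
  rw [interior_Ici, Set.mem_Ioi] at hx
  rw [(hasDerivAt_potential hf x).deriv]
  exact pos_of_mul_pos_right (hpos x hx.ne') hx.le

theorem potential_strictAntiOn {f : ℝ → ℝ} (hf : Continuous f)
    (hpos : ∀ x, x ≠ 0 → 0 < x * f x) : StrictAntiOn (potential f) (Set.Iic 0) := by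
  refine strictAntiOn_of_deriv_neg (convex_Iic 0) (continuous_potential hf).continuousOn ?_
  intro x hx
  rw [interior_Iic, Set.mem_Iio] at hx
  rw [(hasDerivAt_potential hf x).deriv]
  have := hpos x hx.ne
  nlinarith

theorem potential_pos {f : ℝ → ℝ} (hf : Continuous f) (hpos : ∀ x, x ≠ 0 → 0 < x * f x)
    {x : ℝ} (hx : x ≠ 0) : 0 < potential f x := by
  rw [← potential_zero f]
  rcases hx.lt_or_gt with h | h
  · exact potential_strictAntiOn hf hpos h.le Set.self_mem_Iic h
  · exact potential_strictMonoOn hf hpos Set.self_mem_Ici h.le h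

theorem potential_nonneg {f : ℝ → ℝ} (hf : Continuous f) (hpos : ∀ x, x ≠ 0 → 0 < x * f x)
    (x : ℝ) : 0 ≤ potential f x := by
  rcases eq_or_ne x 0 with rfl | hx
  · rw [potential_zero]
  · exact (potential_pos hf hpos hx).le

/-- The potential decreases and then increases, so its sublevel sets are intervals around `0`. -/
theorem abs_lt_of_potential_lt {f : ℝ → ℝ} (hf : Continuous f)
    (hpos : ∀ x, x ≠ 0 → 0 < x * f x) {M x : ℝ} (hM : 0 < M)
    (h1 : potential f x < potential f M) (h2 : potential f x < potential f (-M)) : |x| < M := by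
  rw [abs_lt]
  constructor
  · by_contra! h
    have := (potential_strictAntiOn hf hpos).antitoneOn (a := x) (b := -M)
      (by simp only [Set.mem_Iic]; linarith) (by simp only [Set.mem_Iic]; linarith) h
    linarith
  · by_contra! h
    have := (potential_strictMonoOn hf hpos).monotoneOn (a := M) (b := x)
      (by simp only [Set.mem_Ici]; linarith) (by simp only [Set.mem_Ici]; linarith) h
    linarith

theorem le_potential {f : ℝ → ℝ} (hf : Continuous f) {κ : ℝ}
    (hκ : ∀ x, κ * x ^ 2 ≤ x * f x) (x : ℝ) : κ / 2 * x ^ 2 ≤ potential f x := by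
  have hd : ∀ x, HasDerivAt (fun x => potential f x - κ / 2 * x ^ 2) (f x - κ * x) x := fun x => by
    refine ((hasDerivAt_potential hf x).sub ((hasDerivAt_pow 2 x).const_mul (κ / 2))).congr_deriv ?_
    norm_num
    ring
  have hc : Continuous (fun x => potential f x - κ / 2 * x ^ 2) :=
    continuous_iff_continuousAt.2 fun x => (hd x).continuousAt
  have h0 : potential f 0 - κ / 2 * 0 ^ 2 = 0 := by simp [potential_zero]
  rcases le_total 0 x with hx | hx
  · have hm := monotoneOn_of_deriv_nonneg (convex_Ici 0) hc.continuousOn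
      (fun y _ => (hd y).differentiableAt.differentiableWithinAt) (fun y hy => by
        rw [interior_Ici, Set.mem_Ioi] at hy
        rw [(hd y).deriv]
        have := hκ y
        by_contra! h
        nlinarith) Set.self_mem_Ici hx hx
    simp only at hm
    linarith
  · have hm := antitoneOn_of_deriv_nonpos (convex_Iic 0) hc.continuousOn
      (fun y _ => (hd y).differentiableAt.differentiableWithinAt) (fun y hy => by
        rw [interior_Iic, Set.mem_Iio] at hy
        rw [(hd y).deriv]
        have := hκ y
        by_contra! h
        nlinarith) hx Set.self_mem_Iic hx
    simp only at hm
    linarith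

theorem potential_le {f : ℝ → ℝ} (hf : Continuous f) {L : ℝ}
    (hL : ∀ x, x * f x ≤ L * x ^ 2) (x : ℝ) : potential f x ≤ L / 2 * x ^ 2 := by
  have h := le_potential (f := fun x => -f x) hf.neg (κ := -L) (fun x => by
    have := hL x
    linarith) x
  have : potential (fun x => -f x) x = -potential f x := by
    simp [potential]
  rw [this] at h
  linarith

/-- Damping: along a solution of `v' = r z`, `(r z)' = -F(v, z)` the energy
`(v')² / 2 + potential` decreases if `F` increases in its second variable. -/
theorem energy_le {F : ℝ → ℝ → ℝ} (hFc : Continuous fun x => F x 0)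
    (hF : ∀ x z, 0 ≤ z * (F x z - F x 0)) {v z : ℝ → ℝ}
    (hv : ∀ r, HasDerivAt v (r * z r) r)
    (hp : ∀ r, HasDerivAt (fun r => r * z r) (-F (v r) (z r)) r) {r : ℝ} (hr : 0 ≤ r) :
    (r * z r) ^ 2 / 2 + potential (fun x => F x 0) (v r)
      ≤ potential (fun x => F x 0) (v 0) := by
  have hd : ∀ r, HasDerivAt (fun r => (r * z r) ^ 2 / 2 + potential (fun x => F x 0) (v r))
      (-(r * (z r * (F (v r) (z r) - F (v r) 0)))) r := fun r => by
    refine ((((hp r).pow 2).div_const 2).add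
      ((hasDerivAt_potential hFc (v r)).comp r (hv r))).congr_deriv ?_
    norm_num
    ring
  have hc : Continuous (fun r => (r * z r) ^ 2 / 2 + potential (fun x => F x 0) (v r)) :=
    continuous_iff_continuousAt.2 fun r => (hd r).continuousAt
  have := antitoneOn_of_deriv_nonpos (convex_Ici 0) hc.continuousOn
    (fun y _ => (hd y).differentiableAt.differentiableWithinAt) (fun y hy => by
      rw [interior_Ici, Set.mem_Ioi] at hy
      rw [(hd y).deriv]
      have := mul_nonneg hy.le (hF (v y) (z y))
      linarith) Set.self_mem_Ici hr hr
  simpa using this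

/-- Conservation of the energy `(v')² / 2 + potential` for `v'' = -f(v)`. -/
theorem energy_eq {f : ℝ → ℝ} (hf : Continuous f) {v p : ℝ → ℝ}
    (hv : ∀ r, HasDerivAt v (p r) r) (hp : ∀ r, HasDerivAt p (-f (v r)) r) (r : ℝ) :
    p r ^ 2 / 2 + potential f (v r) = p 0 ^ 2 / 2 + potential f (v 0) := by
  have hd : ∀ r, HasDerivAt (fun r => p r ^ 2 / 2 + potential f (v r)) 0 r := fun r => by
    refine ((((hp r).pow 2).div_const 2).add
      ((hasDerivAt_potential hf (v r)).comp r (hv r))).congr_deriv ?_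
    norm_num
    ring
  exact is_const_of_deriv_eq_zero (fun r => (hd r).differentiableAt) (fun r => (hd r).deriv) r 0

/-! ### Oscillation -/

/-- As long as `v ≠ 0`, the angle `arctan (v' / v)` decreases at a rate bounded away from zero.
As it is bounded, `v` must vanish again and again. -/
theorem exists_zero_ge {v p h : ℝ → ℝ} (hv : ∀ r, HasDerivAt v (p r) r)
    (hp : ∀ r, HasDerivAt p (-h r) r) {m R : ℝ} (hm : 0 < m)
    (hrot : ∀ r, R ≤ r → m * (v r ^ 2 + p r ^ 2) ≤ v r * h r + p r ^ 2) (R' : ℝ) :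
    ∃ r, R' ≤ r ∧ v r = 0 := by
  by_contra! hne
  set S := max R R'
  have hd : ∀ r, S ≤ r → HasDerivAt (fun r => Real.arctan (p r / v r) + m * r)
      (-(v r * h r + p r ^ 2) / (v r ^ 2 + p r ^ 2) + m) r := fun r hr => by
    have h0 := hne r ((le_max_right R R').trans hr)
    have h1 : 0 < v r ^ 2 + p r ^ 2 := by positivity
    refine ((((hp r).div (hv r) h0).arctan).add ((hasDerivAt_id r).const_mul m)).congr_deriv ?_
    simp only [Pi.div_apply]
    field_simp
    ring
  have hanti := antitoneOn_of_deriv_nonpos (convex_Ici S)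
    (fun y hy => (hd y hy).continuousAt.continuousWithinAt)
    (fun y hy => (hd y (interior_subset hy)).differentiableAt.differentiableWithinAt)
    (fun y hy => by
      have hy : S ≤ y := interior_subset hy
      rw [(hd y hy).deriv]
      have h0 := hne y ((le_max_right R R').trans hy)
      have h1 : 0 < v y ^ 2 + p y ^ 2 := by positivity
      have h2 := hrot y ((le_max_left R R').trans hy)
      have h3 : -(v y * h y + p y ^ 2) / (v y ^ 2 + p y ^ 2) ≤ -m := by
        rw [div_le_iff₀ h1]
        linarith
      linarith)
  have hq : 0 ≤ (Real.pi + 1) / m := by positivity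
  have h1 := hanti (a := S) (b := S + (Real.pi + 1) / m) Set.self_mem_Ici
    (by simp only [Set.mem_Ici]; linarith) (by linarith)
  simp only at h1
  have h2 := Real.neg_pi_div_two_lt_arctan
    (p (S + (Real.pi + 1) / m) / v (S + (Real.pi + 1) / m))
  have h3 := Real.arctan_lt_pi_div_two (p S / v S)
  rw [mul_add, mul_div_cancel₀ _ hm.ne'] at h1
  linarith

/-! ### Decay -/

theorem le_rpow_neg_of_mul_deriv_le {Y Y' : ℝ → ℝ} {R s : ℝ} (hR : 0 < R)
    (hY : ∀ r, R ≤ r → HasDerivAt Y (Y' r) r) (hs : ∀ r, R ≤ r → r * Y' r ≤ -(s * Y r)) :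
    ∀ r, R ≤ r → Y r ≤ R ^ s * Y R * r ^ (-s) := by
  have hd : ∀ r, R ≤ r → HasDerivAt (fun r => r ^ s * Y r)
      (r ^ (s - 1) * (s * Y r + r * Y' r)) r := fun r hr => by
    have h0 : 0 < r := hR.trans_le hr
    refine ((Real.hasDerivAt_rpow_const (Or.inl h0.ne')).mul (hY r hr)).congr_deriv ?_
    have : r ^ s = r ^ (s - 1) * r := by
      rw [Real.rpow_sub_one h0.ne', div_mul_cancel₀ _ h0.ne']
    rw [this]
    ring
  have hanti := antitoneOn_of_deriv_nonpos (convex_Ici R)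
    (fun y hy => (hd y hy).continuousAt.continuousWithinAt)
    (fun y hy => (hd y (interior_subset hy)).differentiableAt.differentiableWithinAt)
    (fun y hy => by
      have hy : R ≤ y := interior_subset hy
      rw [(hd y hy).deriv]
      have h1 := hs y hy
      have h2 : 0 ≤ y ^ (s - 1) := Real.rpow_nonneg (hR.le.trans hy) _
      exact mul_nonpos_of_nonneg_of_nonpos h2 (by linarith))
  intro r hr
  have h := hanti Set.self_mem_Ici hr hr
  have h0 : 0 < r := hR.trans_le hr
  have hrs : 0 < r ^ s := Real.rpow_pos_of_pos h0 s
  rw [Real.rpow_neg h0.le, ← div_eq_mul_inv, le_div_iff₀ hrs, mul_comm]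
  exact h

/-- Decay of the solutions of `v'' + f(v) + D = 0` with `f` comparable to the identity and a
damping term `D` comparable to `v' / r`. The energy alone does not dissipate where `v' = 0`; adding
the small multiple `ε v v' / r` of the virial gives a functional `Y`, comparable to `v² + v'²`, with
`r Y' ≤ -s Y`, so that `Y ≤ C r ^ (-s)`. -/
theorem tendsto_zero_of_damping {f : ℝ → ℝ} (hf : Continuous f) {κ L c C : ℝ} (hκ : 0 < κ)
    (hc : 0 < c) (hfκ : ∀ x, κ * x ^ 2 ≤ x * f x) (hfL : ∀ x, x * f x ≤ L * x ^ 2)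
    {v p D : ℝ → ℝ} (hv : ∀ r, HasDerivAt v (p r) r)
    (hp : ∀ r, HasDerivAt p (-(f (v r) + D r)) r)
    (hDc : ∀ r, 0 < r → c * p r ^ 2 ≤ r * (p r * D r))
    (hDC : ∀ r, 0 < r → r * |D r| ≤ C * |p r|) :
    Tendsto (fun r => v r ^ 2 + p r ^ 2) atTop (𝓝 0) := by
  have hL : 0 < L := by
    have h1 := hfκ 1
    have h2 := hfL 1
    linarith
  have hC0 : 0 ≤ max C 0 := le_max_right _ _
  have hDC' : ∀ r, 0 < r → r * |D r| ≤ max C 0 * |p r| := fun r hr =>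
    (hDC r hr).trans (mul_le_mul_of_nonneg_right (le_max_left _ _) (abs_nonneg _))
  generalize max C 0 = C at hC0 hDC'
  set ε := c / 2 with hε
  have hε0 : 0 < ε := by positivity
  -- `k` is the rate of dissipation, `b` and `B` the constants of comparison with `v² + v'²`.
  set k := min (c / 2) (ε * κ) / 2 with hk
  have hk0 : 0 < k := by positivity
  set b := min (1 / 2) (κ / 2) / 2 with hb
  have hb0 : 0 < b := by positivity
  set B := 1 / 2 + L / 2 + b with hB
  have hB0 : 0 < B := by positivity
  set R := 1 + ε * (C + 1) / k + ε / b with hR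
  have hq1 : 0 ≤ ε * (C + 1) / k := by positivity
  have hq2 : 0 ≤ ε / b := by positivity
  have hR0 : 0 < R := by positivity
  let Y : ℝ → ℝ := fun r => p r ^ 2 / 2 + potential f (v r) + ε * (v r * p r / r)
  let Y' : ℝ → ℝ := fun r =>
    -(p r * D r) + ε * ((p r ^ 2 - v r * (f (v r) + D r)) / r - v r * p r / r ^ 2)
  have hvp : ∀ r, 2 * |v r * p r| ≤ v r ^ 2 + p r ^ 2 := fun r => by
    rw [abs_mul, ← sq_abs (v r), ← sq_abs (p r)]
    nlinarith [sq_nonneg (|v r| - |p r|)]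
  have hY : ∀ r, R ≤ r → HasDerivAt Y (Y' r) r := fun r hr => by
    have h0 : 0 < r := hR0.trans_le hr
    refine (((((hp r).pow 2).div_const 2).add ((hasDerivAt_potential hf (v r)).comp r (hv r))).add
      ((((hv r).mul (hp r)).div (hasDerivAt_id r) h0.ne').const_mul ε)).congr_deriv ?_
    simp only [Y', id, Pi.mul_apply]
    field_simp
    norm_num
    ring
  -- Both cross terms are of lower order for `r ≥ R`.
  have hsmall : ∀ r, R ≤ r → ε * (|v r * p r| / r) ≤ b * (v r ^ 2 + p r ^ 2) ∧
      ε * ((C + 1) * |v r * p r| / r) ≤ k * (v r ^ 2 + p r ^ 2) := fun r hr => by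
    have h0 : 0 < r := hR0.trans_le hr
    have hn := abs_nonneg (v r * p r)
    have h1 := hvp r
    constructor
    · have : ε ≤ b * r := by
        rw [← div_le_iff₀' hb0]
        linarith
      have e1 := mul_le_mul_of_nonneg_right this hn
      have e2 := mul_le_mul_of_nonneg_left h1 (mul_pos hb0 h0).le
      have e3 := mul_nonneg (mul_pos hb0 h0).le hn
      rw [← mul_div_assoc, div_le_iff₀ h0]
      linarith
    · have : ε * (C + 1) ≤ k * r := by
        rw [← div_le_iff₀' hk0]
        linarith
      have e1 := mul_le_mul_of_nonneg_right this hn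
      have e2 := mul_le_mul_of_nonneg_left h1 (mul_pos hk0 h0).le
      have e3 := mul_nonneg (mul_pos hk0 h0).le hn
      rw [← mul_div_assoc, div_le_iff₀ h0]
      linarith
  have hYlow : ∀ r, R ≤ r → b * (v r ^ 2 + p r ^ 2) ≤ Y r := fun r hr => by
    have h0 : 0 < r := hR0.trans_le hr
    have h1 := le_potential hf hfκ (v r)
    have h2 := (hsmall r hr).1
    have h3 : -(|v r * p r| / r) ≤ v r * p r / r := by
      rw [← neg_div]
      exact div_le_div_of_nonneg_right (neg_abs_le _) h0.le
    have h4 := mul_le_mul_of_nonneg_left h3 hε0.le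
    have h5 : 2 * b ≤ 1 / 2 := by
      rw [hb]
      linarith [min_le_left (1 / 2) (κ / 2)]
    have h6 : 2 * b ≤ κ / 2 := by
      rw [hb]
      linarith [min_le_right (1 / 2) (κ / 2)]
    have h7 := mul_le_mul_of_nonneg_right h5 (sq_nonneg (p r))
    have h8 := mul_le_mul_of_nonneg_right h6 (sq_nonneg (v r))
    simp only [Y]
    linarith
  have hYup : ∀ r, R ≤ r → Y r ≤ B * (v r ^ 2 + p r ^ 2) := fun r hr => by
    have h0 : 0 < r := hR0.trans_le hr
    have h1 := potential_le hf hfL (v r)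
    have h2 := (hsmall r hr).1
    have h3 : v r * p r / r ≤ |v r * p r| / r := div_le_div_of_nonneg_right (le_abs_self _) h0.le
    have h4 := mul_le_mul_of_nonneg_left h3 hε0.le
    have h5 := mul_nonneg hL.le (sq_nonneg (p r))
    have h6 := sq_nonneg (v r)
    simp only [Y, hB]
    linarith
  have hdiss : ∀ r, R ≤ r → r * Y' r ≤ -(k / B * Y r) := fun r hr => by
    have h0 : 0 < r := hR0.trans_le hr
    have h1 := hDc r h0
    have h2 : |v r * D r| ≤ C * |v r * p r| / r := by
      rw [le_div_iff₀ h0, abs_mul, abs_mul]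
      have := mul_le_mul_of_nonneg_left (hDC' r h0) (abs_nonneg (v r))
      linarith
    have h3 := (hsmall r hr).2
    have h4 := hfκ (v r)
    have h5 : r * Y' r = -(r * (p r * D r)) + ε * (p r ^ 2 - v r * f (v r))
        - ε * (v r * D r + v r * p r / r) := by
      simp only [Y']
      field_simp
      ring
    have h6 : -(v r * D r + v r * p r / r) ≤ (C + 1) * |v r * p r| / r := by
      have e1 := neg_abs_le (v r * D r)
      have e2 : -(|v r * p r| / r) ≤ v r * p r / r := by
        rw [← neg_div]
        exact div_le_div_of_nonneg_right (neg_abs_le _) h0.le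
      have e3 : (C + 1) * |v r * p r| / r = C * |v r * p r| / r + |v r * p r| / r := by ring
      linarith
    have h7 := mul_le_mul_of_nonneg_left h6 hε0.le
    have h8 := mul_le_mul_of_nonneg_left h4 hε0.le
    have h9 : 2 * k ≤ c / 2 := by
      rw [hk]
      linarith [min_le_left (c / 2) (ε * κ)]
    have h10 : 2 * k ≤ ε * κ := by
      rw [hk]
      linarith [min_le_right (c / 2) (ε * κ)]
    have h11 := mul_le_mul_of_nonneg_right h9 (sq_nonneg (p r))
    have h12 := mul_le_mul_of_nonneg_right h10 (sq_nonneg (v r))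
    have h13 : k / B * Y r ≤ k * (v r ^ 2 + p r ^ 2) := by
      have := mul_le_mul_of_nonneg_left (hYup r hr) (div_pos hk0 hB0).le
      rwa [← mul_assoc, div_mul_cancel₀ _ hB0.ne'] at this
    have h14 : ε * p r ^ 2 = c / 2 * p r ^ 2 := rfl
    rw [h5]
    linarith
  have hle := le_rpow_neg_of_mul_deriv_le hR0 hY hdiss
  have hlim : Tendsto (fun r : ℝ => R ^ (k / B) * Y R * r ^ (-(k / B)) / b) atTop (𝓝 0) := by
    have := ((tendsto_rpow_neg_atTop (div_pos hk0 hB0)).const_mul (R ^ (k / B) * Y R)).div_const b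
    simpa using this
  refine tendsto_of_tendsto_of_tendsto_of_le_of_le' tendsto_const_nhds hlim
    (Eventually.of_forall fun r => by positivity) ?_
  filter_upwards [eventually_ge_atTop R] with r hr
  rw [le_div_iff₀ hb0, mul_comm]
  exact (hYlow r hr).trans (hle r hr)

/-! ### The autonomous equation: periodicity -/

/-- A solution of `v'' = -f(v)` is symmetric about its critical points. -/
theorem reflect_eq {f : ℝ → ℝ} {K : NNReal} (hf : LipschitzWith K f) {v p : ℝ → ℝ}
    (hv : ∀ r, HasDerivAt v (p r) r) (hp : ∀ r, HasDerivAt p (-f (v r)) r) {T : ℝ}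
    (hT : p T = 0) (t : ℝ) : v (2 * T - t) = v t := by
  have hlip : LipschitzWith (max 1 K) (fun q : ℝ × ℝ => (q.2, -f q.1)) := by
    have h2 : LipschitzWith K (fun q : ℝ × ℝ => -f q.1) := by
      have := (hf.comp (LipschitzWith.prod_fst (α := ℝ) (β := ℝ))).neg
      rwa [mul_one] at this
    exact LipschitzWith.prod_snd.prodMk h2
  have hrefl : ∀ t, HasDerivAt (fun t => 2 * T - t) (-1) t := fun t => by
    simpa using (hasDerivAt_id t).const_sub (2 * T)
  have h := ODE_solution_unique_univ (v := fun (_ : ℝ) (q : ℝ × ℝ) => (q.2, -f q.1))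
    (s := fun _ => Set.univ)
    (K := max 1 K) (t₀ := T) (f := fun t => (v (2 * T - t), -p (2 * T - t)))
    (g := fun t => (v t, p t)) (fun _ => hlip.lipschitzOnWith)
    (fun t => ⟨HasDerivAt.prodMk
      (((hv (2 * T - t)).comp t (hrefl t)).congr_deriv (by ring))
      (((hp (2 * T - t)).comp t (hrefl t)).neg.congr_deriv (by ring)), Set.mem_univ _⟩)
    (fun t => ⟨(hv t).prodMk (hp t), Set.mem_univ _⟩)
    (by simp [show 2 * T - T = T by ring, hT])
  exact congrArg Prod.fst (congrFun h t)

/-- On a positive energy level the phase point `(x, y)` stays away from the origin, so by compactness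
its angular velocity is bounded away from zero. -/
theorem exists_rotation_bound {f : ℝ → ℝ} (hf : Continuous f)
    (hpos : ∀ x, x ≠ 0 → 0 < x * f x) {e : ℝ} (he : 0 < e) (M : ℝ) :
    ∃ m, 0 < m ∧ ∀ x y, |x| ≤ M → y ^ 2 / 2 + potential f x = e →
      m * (x ^ 2 + y ^ 2) ≤ x * f x + y ^ 2 := by
  set S : Set (ℝ × ℝ) := (Set.Icc (-M) M ×ˢ Set.Icc (-(2 * e + 1)) (2 * e + 1)) ∩
    {q | q.2 ^ 2 / 2 + potential f q.1 = e} with hS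
  have hpc := continuous_potential hf
  have hSc : IsCompact S := (isCompact_Icc.prod isCompact_Icc).inter_right
    (isClosed_eq (by fun_prop) continuous_const)
  obtain ⟨m₀, hm₀, hmin⟩ := hSc.exists_forall_le' (f := fun q : ℝ × ℝ => q.1 * f q.1 + q.2 ^ 2)
    (by fun_prop) (a := 0) (fun q hq => by
      rcases eq_or_ne q.1 0 with h | h
      · have h2 : q.2 ^ 2 / 2 + potential f q.1 = e := hq.2
        rw [h, potential_zero] at h2
        simp only [h]
        linarith
      · have := hpos q.1 h
        positivity)
  refine ⟨m₀ / (M ^ 2 + 2 * e), by positivity, fun x y hx hy => ?_⟩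
  have hpn := potential_nonneg hf hpos x
  have hy2 : y ^ 2 ≤ 2 * e := by linarith
  have hx2 : x ^ 2 ≤ M ^ 2 := sq_le_sq' (abs_le.1 hx).1 (abs_le.1 hx).2
  have hyabs : |y| ≤ 2 * e + 1 := abs_le_of_sq_le_sq (by nlinarith) (by positivity)
  have h := hmin (x, y) ⟨⟨abs_le.1 hx, abs_le.1 hyabs⟩, hy⟩
  refine le_trans ?_ h
  rw [div_mul_eq_mul_div, div_le_iff₀ (by positivity)]
  exact mul_le_mul_of_nonneg_left (by linarith) hm₀.le

/-- A bounded solution of `v'' = -f(v)` with `v'(0) = 0` and `v(0) ≠ 0` is even, periodic and has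
arbitrarily large zeros: it oscillates, so by Rolle it has a second critical point, and it is
symmetric about both. -/
theorem even_periodic_oscillating {f : ℝ → ℝ} {K : NNReal} (hf : LipschitzWith K f)
    (hpos : ∀ x, x ≠ 0 → 0 < x * f x) {v p : ℝ → ℝ}
    (hv : ∀ r, HasDerivAt v (p r) r) (hp : ∀ r, HasDerivAt p (-f (v r)) r)
    (hp0 : p 0 = 0) (hv0 : v 0 ≠ 0) {M : ℝ} (hM : ∀ r, 0 ≤ r → |v r| ≤ M) :
    (∀ r, v (-r) = v r) ∧ (∃ T, T ≠ 0 ∧ ∀ r, v (r + T) = v r) ∧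
      ∀ R, ∃ r, R ≤ r ∧ v r = 0 := by
  have heven : ∀ r, v (-r) = v r := fun r => by
    simpa using reflect_eq hf hv hp hp0 r
  obtain ⟨m, hm, hrot⟩ := exists_rotation_bound hf.continuous hpos
    (potential_pos hf.continuous hpos hv0) M
  have hosc : ∀ R, ∃ r, R ≤ r ∧ v r = 0 :=
    exists_zero_ge hv hp (R := 0) hm (fun r hr => hrot _ _ (hM r hr) (by
      rw [energy_eq hf.continuous hv hp r, hp0]
      ring))
  refine ⟨heven, ?_, hosc⟩
  obtain ⟨r₁, h1, hz1⟩ := hosc 1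
  obtain ⟨r₂, h2, hz2⟩ := hosc (r₁ + 1)
  obtain ⟨T, hT, hT0⟩ := exists_hasDerivAt_eq_zero (f := v) (f' := p) (a := r₁) (b := r₂)
    (by linarith) (fun r _ => (hv r).continuousAt.continuousWithinAt) (hz1.trans hz2.symm)
    (fun r _ => hv r)
  have hT1 := hT.1
  refine ⟨2 * T, by linarith, fun r => ?_⟩
  rw [← heven r, ← reflect_eq hf hv hp hT0 (-r)]
  congr 1
  ring

/-! ### The scalar Pucci function -/

/-- The contribution of an eigenvalue `s` to a Pucci operator: slope `a` on the positive and `b` on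
the negative half-line. -/
def pucciFun (a b s : ℝ) : ℝ := a * max s 0 + b * min s 0

theorem pucciFun_zero (a b : ℝ) : pucciFun a b 0 = 0 := by simp [pucciFun]

theorem pucciFun_sub_bounds {a b l u s t : ℝ} (hla : l ≤ a) (hlb : l ≤ b) (hau : a ≤ u)
    (hbu : b ≤ u) (hst : s ≤ t) :
    l * (t - s) ≤ pucciFun a b t - pucciFun a b s ∧
      pucciFun a b t - pucciFun a b s ≤ u * (t - s) := by
  have hmax : 0 ≤ max t 0 - max s 0 := sub_nonneg.2 (max_le_max_right 0 hst)
  have hmin : 0 ≤ min t 0 - min s 0 := sub_nonneg.2 (min_le_min_right 0 hst)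
  have ht := max_add_min t 0
  have hs := max_add_min s 0
  have hsum : t - s = (max t 0 - max s 0) + (min t 0 - min s 0) := by linarith
  have hd : pucciFun a b t - pucciFun a b s =
      a * (max t 0 - max s 0) + b * (min t 0 - min s 0) := by
    simp only [pucciFun]
    ring
  rw [hd, hsum, mul_add, mul_add]
  exact ⟨add_le_add (mul_le_mul_of_nonneg_right hla hmax) (mul_le_mul_of_nonneg_right hlb hmin),
    add_le_add (mul_le_mul_of_nonneg_right hau hmax) (mul_le_mul_of_nonneg_right hbu hmin)⟩

theorem abs_pucciFun_sub_le {a b u : ℝ} (ha : 0 ≤ a) (hb : 0 ≤ b) (hau : a ≤ u) (hbu : b ≤ u)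
    (s t : ℝ) : |pucciFun a b s - pucciFun a b t| ≤ u * |s - t| := by
  wlog hst : s ≤ t generalizing s t
  · rw [abs_sub_comm, abs_sub_comm s]
    exact this t s (le_of_not_ge hst)
  · have h := pucciFun_sub_bounds ha hb hau hbu hst
    rw [abs_sub_comm, abs_sub_comm s, abs_of_nonneg (sub_nonneg.2 hst), abs_of_nonneg (by linarith)]
    exact h.2

theorem pucciFun_neg_pucciFun_inv {a b : ℝ} (ha : 0 < a) (hb : 0 < b) (y : ℝ) :
    pucciFun a b (-pucciFun b⁻¹ a⁻¹ y) = -y := by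
  rcases le_total 0 y with h | h
  · have h1 : pucciFun b⁻¹ a⁻¹ y = b⁻¹ * y := by simp [pucciFun, h]
    have h2 : -(b⁻¹ * y) ≤ 0 := by
      rw [neg_nonpos]
      positivity
    rw [h1, pucciFun, max_eq_right h2, min_eq_left h2]
    field_simp
    simp
  · have h1 : pucciFun b⁻¹ a⁻¹ y = a⁻¹ * y := by simp [pucciFun, h]
    have h2 : 0 ≤ -(a⁻¹ * y) := by
      rw [neg_nonneg]
      exact mul_nonpos_of_nonneg_of_nonpos (by positivity) h
    rw [h1, pucciFun, max_eq_left h2, min_eq_right h2]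
    field_simp
    simp

/-- The radial equation solved for the second derivative: with `z = v' / r` and `m = N - 1`, it
reads `v'' = -radialForce a b m G v z`. -/
noncomputable def radialForce (a b m : ℝ) (G : ℝ → ℝ) (x z : ℝ) : ℝ :=
  pucciFun b⁻¹ a⁻¹ (G x + m * pucciFun a b z)

theorem pucciFun_radialForce {a b : ℝ} (ha : 0 < a) (hb : 0 < b) (m : ℝ) (G : ℝ → ℝ) (x z : ℝ) :
    pucciFun a b (-radialForce a b m G x z) + m * pucciFun a b z + G x = 0 := by
  rw [radialForce, pucciFun_neg_pucciFun_inv ha hb]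
  ring

theorem continuous_pucciFun (a b : ℝ) : Continuous (pucciFun a b) := by
  unfold pucciFun
  fun_prop

theorem continuous_radialForce (a b m : ℝ) {G v z : ℝ → ℝ} (hG : Continuous G)
    (hv : Continuous v) (hz : Continuous z) :
    Continuous fun r => radialForce a b m G (v r) (z r) := by
  have h1 := continuous_pucciFun a b
  have h2 := continuous_pucciFun b⁻¹ a⁻¹
  unfold radialForce
  fun_prop

section

variable {a b l u m : ℝ} {G : ℝ → ℝ}

theorem radialForce_sub_bounds (hl : 0 < l) (hla : l ≤ a) (hlb : l ≤ b) (hau : a ≤ u)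
    (hbu : b ≤ u) (hm : 0 ≤ m) (x : ℝ) {z z' : ℝ} (hz : z ≤ z') :
    u⁻¹ * (m * l) * (z' - z) ≤ radialForce a b m G x z' - radialForce a b m G x z ∧
      radialForce a b m G x z' - radialForce a b m G x z ≤ l⁻¹ * (m * u) * (z' - z) := by
  have ha := hl.trans_le hla
  have hb := hl.trans_le hlb
  have hu := ha.trans_le hau
  have h1 := pucciFun_sub_bounds hla hlb hau hbu hz
  have e1 := mul_le_mul_of_nonneg_left h1.1 hm
  have e2 := mul_le_mul_of_nonneg_left h1.2 hm
  have e3 : 0 ≤ m * (l * (z' - z)) := mul_nonneg hm (mul_nonneg hl.le (by linarith))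
  have h2 := pucciFun_sub_bounds (a := b⁻¹) (b := a⁻¹) (l := u⁻¹) (u := l⁻¹)
    (s := G x + m * pucciFun a b z) (t := G x + m * pucciFun a b z')
    (inv_anti₀ hb hbu) (inv_anti₀ ha hau) (inv_anti₀ hl hlb) (inv_anti₀ hl hla) (by linarith)
  constructor
  · refine le_trans ?_ h2.1
    rw [mul_assoc]
    exact mul_le_mul_of_nonneg_left (by linarith) (inv_pos.2 hu).le
  · refine h2.2.trans ?_
    rw [mul_assoc]
    exact mul_le_mul_of_nonneg_left (by linarith) (inv_pos.2 hl).le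

theorem abs_radialForce_sub_le {K : NNReal} (hG : LipschitzWith K G) (hl : 0 < l)
    (hla : l ≤ a) (hlb : l ≤ b) (x x' z : ℝ) :
    |radialForce a b m G x z - radialForce a b m G x' z| ≤ l⁻¹ * K * |x - x'| := by
  have ha := hl.trans_le hla
  have hb := hl.trans_le hlb
  refine (abs_pucciFun_sub_le (inv_pos.2 hb).le (inv_pos.2 ha).le (inv_anti₀ hl hlb)
    (inv_anti₀ hl hla) _ _).trans ?_
  rw [mul_assoc, add_sub_add_right_eq_sub]
  exact mul_le_mul_of_nonneg_left (hG.dist_le_mul x x') (inv_pos.2 hl).le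

theorem radialForce_zero_right (x : ℝ) : radialForce a b m G x 0 = pucciFun b⁻¹ a⁻¹ (G x) := by
  rw [radialForce, pucciFun_zero, mul_zero, add_zero]

theorem le_mul_radialForce_zero (hl : 0 < l) (hla : l ≤ a) (hlb : l ≤ b) (hau : a ≤ u)
    (hbu : b ≤ u) {x : ℝ} (hx : 0 ≤ x * G x) :
    u⁻¹ * (x * G x) ≤ x * radialForce a b m G x 0 := by
  have ha := hl.trans_le hla
  have hb := hl.trans_le hlb
  have hpos : ∀ {s t : ℝ}, s ≤ t → u⁻¹ * (t - s) ≤ pucciFun b⁻¹ a⁻¹ t - pucciFun b⁻¹ a⁻¹ s :=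
    fun h => (pucciFun_sub_bounds (inv_anti₀ hb hbu) (inv_anti₀ ha hau) (inv_anti₀ hl hlb)
      (inv_anti₀ hl hla) h).1
  rw [radialForce_zero_right]
  rcases lt_trichotomy x 0 with h | rfl | h
  · have hG : G x ≤ 0 := by
      by_contra! h'
      nlinarith
    have := hpos hG
    rw [pucciFun_zero] at this
    nlinarith
  · simp
  · have hG : 0 ≤ G x := nonneg_of_mul_nonneg_right hx h
    have := hpos hG
    rw [pucciFun_zero] at this
    nlinarith

end

/-! ### Extension of the nonlinearity -/

/-- The nonlinearity near `0`, continued with slope `1`. -/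
def linearExtension (g : ℝ → ℝ) (M x : ℝ) : ℝ :=
  g (max (-M) (min x M)) + (x - max (-M) (min x M))

theorem linearExtension_of_abs_le {g : ℝ → ℝ} {M x : ℝ} (hx : |x| ≤ M) :
    linearExtension g M x = g x := by
  have h := abs_le.1 hx
  rw [linearExtension, min_eq_left h.2, max_eq_right h.1, sub_self, add_zero]

theorem linearExtension_of_le {g : ℝ → ℝ} {M x : ℝ} (hM : 0 ≤ M) (hx : M ≤ x) :
    linearExtension g M x = g M + (x - M) := by
  rw [linearExtension, min_eq_right hx, max_eq_right (by linarith)]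

theorem linearExtension_of_le_neg {g : ℝ → ℝ} {M x : ℝ} (hM : 0 ≤ M) (hx : x ≤ -M) :
    linearExtension g M x = g (-M) + (x + M) := by
  rw [linearExtension, min_eq_left (by linarith), max_eq_left hx, sub_neg_eq_add]

theorem exists_lipschitzWith_linearExtension {g : ℝ → ℝ} (hg : LocallyLipschitz g) {M : ℝ}
    (hM : 0 ≤ M) : ∃ K, LipschitzWith K (linearExtension g M) := by
  obtain ⟨K, hK⟩ := (hg.locallyLipschitzOn (s := Set.Icc (-M) M)).exists_lipschitzOnWith_of_compact
    isCompact_Icc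
  have hc : LipschitzWith 1 (fun x : ℝ => max (-M) (min x M)) :=
    (LipschitzWith.id.min_const M).const_max (-M)
  have hgc : LipschitzWith (K * 1) (fun x : ℝ => g (max (-M) (min x M))) := by
    have := hK.comp (hc.lipschitzOnWith (s := Set.univ)) (fun x _ =>
      ⟨le_max_left _ _, max_le (by linarith) (min_le_right _ _)⟩)
    exact lipschitzOnWith_univ.1 this
  exact ⟨_, hgc.add (LipschitzWith.id.sub hc)⟩

theorem le_mul_linearExtension {g : ℝ → ℝ} {M κ : ℝ} (hM : 0 < M) (hκ1 : κ ≤ 1)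
    (hκ : ∀ x, |x| ≤ M → κ * x ^ 2 ≤ x * g x) (x : ℝ) :
    κ * x ^ 2 ≤ x * linearExtension g M x := by
  rcases le_total |x| M with h | h
  · rw [linearExtension_of_abs_le h]
    exact hκ x h
  · rcases le_abs'.1 h with h | h
    · rw [linearExtension_of_le_neg hM.le h]
      have h1 := hκ (-M) (by rw [abs_neg, abs_of_pos hM])
      have h2 : g (-M) ≤ -(κ * M) := by
        by_contra! h'
        nlinarith
      have h3 := mul_le_mul_of_nonneg_right hκ1 (show 0 ≤ -(x + M) by linarith)
      have h4 := mul_le_mul_of_nonneg_left (show κ * -x ≤ -(g (-M) + (x + M)) by linarith)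
        (show 0 ≤ -x by linarith)
      linarith
    · rw [linearExtension_of_le hM.le h]
      have h1 := hκ M (by rw [abs_of_pos hM])
      have h2 : κ * M ≤ g M := by
        by_contra! h'
        nlinarith
      have h3 := mul_le_mul_of_nonneg_right hκ1 (show 0 ≤ x - M by linarith)
      have h4 := mul_le_mul_of_nonneg_left (show κ * x ≤ g M + (x - M) by linarith)
        (show 0 ≤ x by linarith)
      linarith

theorem mul_linearExtension_pos {g : ℝ → ℝ} {M : ℝ} (hM : 0 < M)
    (hg : ∀ x, x ≠ 0 → |x| ≤ M → 0 < x * g x) (x : ℝ) (hx : x ≠ 0) :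
    0 < x * linearExtension g M x := by
  rcases le_total |x| M with h | h
  · rw [linearExtension_of_abs_le h]
    exact hg x hx h
  · rcases le_abs'.1 h with h | h
    · rw [linearExtension_of_le_neg hM.le h]
      have h1 := hg (-M) (by linarith) (by rw [abs_neg, abs_of_pos hM])
      have h2 : g (-M) < 0 := by
        by_contra! h'
        nlinarith
      exact mul_pos_of_neg_of_neg (by linarith) (by linarith)
    · rw [linearExtension_of_le hM.le h]
      have h1 := hg M hM.ne' (by rw [abs_of_pos hM])
      have h2 : 0 < g M := pos_of_mul_pos_right h1 hM.le
      exact mul_pos (by linarith) (by linarith)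

theorem exists_pos_mul_pos {g : ℝ → ℝ} (hodd : ∀ t, g (-t) = -g t) (hs : SignCondition g) :
    ∃ M, 0 < M ∧ ∀ x, x ≠ 0 → |x| ≤ M → 0 < x * g x := by
  obtain ⟨α, hα, hpos, -⟩ := hs
  obtain ⟨M, hM0, hMα⟩ := EReal.lt_iff_exists_real_btwn.1 hα
  refine ⟨M, by exact_mod_cast hM0, fun x hx hxM => ?_⟩
  have habs : 0 < g |x| := hpos _ (abs_pos.2 hx)
    ((EReal.coe_le_coe_iff.2 hxM).trans_lt hMα)
  rcases hx.lt_or_gt with h | h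
  · rw [abs_of_neg h, hodd] at habs
    nlinarith
  · rw [abs_of_pos h] at habs
    positivity

/-- A positive derivative at `0` makes `g` comparable to the identity near `0`. -/
theorem exists_coercive {g : ℝ → ℝ} (h0 : g 0 = 0) (hd : DifferentiableAt ℝ g 0)
    (hg : 0 < deriv g 0) :
    ∃ κ M, 0 < κ ∧ κ ≤ 1 ∧ 0 < M ∧ ∀ x, |x| ≤ M → κ * x ^ 2 ≤ x * g x := by
  have ht := hasDerivAt_iff_tendsto_slope.1 hd.hasDerivAt
  have hev := ht.eventually (lt_mem_nhds (show deriv g 0 / 2 < deriv g 0 by linarith))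
  rw [eventually_nhdsWithin_iff] at hev
  obtain ⟨δ, hδ, hball⟩ := Metric.eventually_nhds_iff.1 hev
  refine ⟨min (deriv g 0 / 2) 1, δ / 2, by positivity, min_le_right _ _, by positivity,
    fun x hx => ?_⟩
  rcases eq_or_ne x 0 with rfl | hx0
  · simp
  · have h1 := hball (y := x) (by rw [Real.dist_eq, sub_zero]; linarith) hx0
    rw [slope_def_field, h0, sub_zero, sub_zero] at h1
    have hx2 : 0 < x ^ 2 := by positivity
    have h2 := mul_lt_mul_of_pos_right h1 hx2
    have h3 : g x / x * x ^ 2 = x * g x := by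
      field_simp
    have h4 := mul_le_mul_of_nonneg_right (min_le_left (deriv g 0 / 2) 1) hx2.le
    linarith

/-! ### Radial functions -/

theorem continuous_add_div_norm_sq_smul {E V : Type*} [NormedAddCommGroup E]
    [NormedAddCommGroup V] [NormedSpace ℝ V]
    {z w : ℝ → ℝ} (hz : Continuous z) (hw : Continuous w) (h0 : w 0 = z 0) (A : V) {B : E → V}
    (hB : Continuous B) (hBn : ∀ x, ‖B x‖ ≤ ‖x‖ ^ 2) :
    Continuous fun x : E => z ‖x‖ • A + ((w ‖x‖ - z ‖x‖) / ‖x‖ ^ 2) • B x := by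
  refine Continuous.add (by fun_prop) ?_
  rw [continuous_iff_continuousAt]
  intro x
  rcases eq_or_ne x 0 with rfl | hx
  · have hlim : Tendsto (fun x : E => |w ‖x‖ - z ‖x‖|) (𝓝 0) (𝓝 0) := by
      have : Continuous (fun x : E => |w ‖x‖ - z ‖x‖|) := by fun_prop
      simpa [h0] using this.tendsto (0 : E)
    rw [ContinuousAt]
    simp only [norm_zero, ne_eq, OfNat.ofNat_ne_zero, not_false_eq_true, zero_pow, div_zero,
      zero_smul]
    refine squeeze_zero_norm (fun y => ?_) hlim
    rw [norm_smul, norm_div, norm_pow, norm_norm, Real.norm_eq_abs]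
    exact (mul_le_mul_of_nonneg_left (hBn y) (by positivity)).trans <| by
      rw [div_mul_eq_mul_div]
      exact div_le_of_le_mul₀ (by positivity) (abs_nonneg _) le_rfl
  · have hn : ‖x‖ ^ 2 ≠ 0 := pow_ne_zero 2 (norm_ne_zero_iff.2 hx)
    exact ContinuousAt.smul (ContinuousAt.div (by fun_prop) (by fun_prop) hn) hB.continuousAt

section

variable {E : Type*} [NormedAddCommGroup E] [InnerProductSpace ℝ E]

/-- The real inner product as an `ℝ`-bilinear form; `innerSL ℝ` is formally conjugate-linear in its
first argument. -/
noncomputable def innerBilin (E : Type*) [NormedAddCommGroup E] [InnerProductSpace ℝ E] :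
    E →L[ℝ] E →L[ℝ] ℝ := innerSL ℝ

@[simp]
theorem innerBilin_apply (x : E) : innerBilin E x = innerSL ℝ x := rfl

theorem hasFDerivAt_norm_of_ne_zero {x : E} (hx : x ≠ 0) :
    HasFDerivAt (fun x : E => ‖x‖) (‖x‖⁻¹ • innerSL ℝ x) x := by
  have h := (hasStrictFDerivAt_norm_sq x).hasFDerivAt
  have h2 := h.sqrt (by positivity)
  simp only [Real.sqrt_sq (norm_nonneg _)] at h2
  convert h2 using 1
  ext y
  simp
  field_simp

theorem hasFDerivAt_radial {v z : ℝ → ℝ} (hv : ∀ r, HasDerivAt v (r * z r) r) (x : E) :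
    HasFDerivAt (fun x : E => v ‖x‖) (z ‖x‖ • innerSL ℝ x) x := by
  rcases eq_or_ne x 0 with rfl | hx
  · have h := (hasDerivAt_iff_isLittleO.1 (hv 0)).comp_tendsto
      (show Tendsto (fun x : E => ‖x‖) (𝓝 0) (𝓝 0) by simpa using continuous_norm.tendsto (0 : E))
    rw [hasFDerivAt_iff_isLittleO]
    refine (h.congr_left (f₂ := fun x' : E => v ‖x'‖ - v ‖(0 : E)‖ -
      (z ‖(0 : E)‖ • innerSL ℝ (0 : E)) (x' - 0)) fun x' => by simp).trans_isBigO ?_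
    refine Asymptotics.IsBigO.of_bound 1 (Eventually.of_forall fun x' => by simp)
  · have h := (hv ‖x‖).comp_hasFDerivAt x (hasFDerivAt_norm_of_ne_zero hx)
    have hn : ‖x‖ ≠ 0 := norm_ne_zero_iff.2 hx
    refine h.congr_fderiv ?_
    rw [smul_smul]
    congr 1
    field_simp

/-- The Hessian at `x` of `x ↦ v ‖x‖`, as a bilinear form, in terms of `z = v' / r` and `w = v''`:
it is `z` times the identity plus `w - z` times the projection onto the direction of `x`. At `x = 0`
the second summand is `0` by the convention for division, which is correct since `w(0) = z(0)`. -/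
noncomputable def radialHessian (z w : ℝ → ℝ) (x : E) : E →L[ℝ] E →L[ℝ] ℝ :=
  z ‖x‖ • innerBilin E + ((w ‖x‖ - z ‖x‖) / ‖x‖ ^ 2) • (innerSL ℝ x).smulRight (innerSL ℝ x)

set_option synthInstance.maxHeartbeats 200000 in
theorem hasFDerivAt_radial_gradient {z w : ℝ → ℝ} (hz : Continuous z)
    (hp : ∀ r, HasDerivAt (fun r => r * z r) (w r) r) (x : E) :
    HasFDerivAt (fun x : E => z ‖x‖ • innerSL ℝ x) (radialHessian z w x) x := by
  have hJ : HasFDerivAt (fun x : E => innerSL ℝ x) (innerBilin E) x :=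
    (innerBilin E).hasFDerivAt
  rcases eq_or_ne x 0 with rfl | hx
  · rw [hasFDerivAt_iff_isLittleO, Asymptotics.isLittleO_iff]
    intro c hc
    have hzc : Tendsto (fun x : E => z ‖x‖) (𝓝 0) (𝓝 (z 0)) := by
      have : Continuous (fun x : E => z ‖x‖) := by fun_prop
      simpa using this.tendsto (0 : E)
    filter_upwards [Metric.tendsto_nhds.1 hzc c hc] with y hy
    have : z ‖y‖ • innerSL ℝ y - z ‖(0 : E)‖ • innerSL ℝ (0 : E) - radialHessian z w 0 (y - 0) =
        (z ‖y‖ - z 0) • innerSL ℝ y := by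
      ext t
      simp [radialHessian]
      ring
    rw [this, norm_smul, innerSL_apply_norm, sub_zero]
    exact mul_le_mul_of_nonneg_right hy.le (norm_nonneg _)
  · have hn : ‖x‖ ≠ 0 := norm_ne_zero_iff.2 hx
    have hzd : HasDerivAt z ((w ‖x‖ - z ‖x‖) / ‖x‖) ‖x‖ := by
      have h := (hp ‖x‖).div (hasDerivAt_id ‖x‖) hn
      refine (h.congr_of_eventuallyEq ?_).congr_deriv ?_
      · filter_upwards [isOpen_ne.mem_nhds hn] with t ht
        have ht : t ≠ 0 := ht
        simp [ht]
      · simp only [id]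
        field_simp
    have h := (hzd.comp_hasFDerivAt x (hasFDerivAt_norm_of_ne_zero hx)).smul hJ
    refine h.congr_fderiv ?_
    ext s t
    simp [radialHessian]
    field_simp

theorem abs_radialHessian_apply_le (z w : ℝ → ℝ) (x s t : E) :
    |radialHessian z w x s t| ≤ (|z ‖x‖| + |w ‖x‖ - z ‖x‖|) * (‖s‖ * ‖t‖) := by
  have h1 := abs_real_inner_le_norm s t
  have h2 := abs_real_inner_le_norm x s
  have h3 := abs_real_inner_le_norm x t
  have h4 : |(w ‖x‖ - z ‖x‖) / ‖x‖ ^ 2 * (inner ℝ x s * inner ℝ x t)|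
      ≤ |w ‖x‖ - z ‖x‖| * (‖s‖ * ‖t‖) := by
    rcases eq_or_ne x 0 with rfl | hx
    · simp
      positivity
    · have hn : 0 < ‖x‖ := norm_pos_iff.2 hx
      rw [abs_mul, abs_div, abs_mul, abs_of_pos (pow_pos hn 2), div_mul_eq_mul_div,
        div_le_iff₀ (by positivity)]
      calc _ ≤ |w ‖x‖ - z ‖x‖| * ((‖x‖ * ‖s‖) * (‖x‖ * ‖t‖)) := by gcongr
        _ = _ := by ring
  have h5 : radialHessian z w x s t = z ‖x‖ * inner ℝ s t +
      (w ‖x‖ - z ‖x‖) / ‖x‖ ^ 2 * (inner ℝ x s * inner ℝ x t) := by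
    simp [radialHessian]
  rw [h5, add_mul]
  refine (abs_add_le _ _).trans (add_le_add ?_ h4)
  rw [abs_mul]
  gcongr

theorem continuous_radialHessian {z w : ℝ → ℝ} (hz : Continuous z) (hw : Continuous w)
    (h0 : w 0 = z 0) : Continuous (radialHessian z w : E → E →L[ℝ] E →L[ℝ] ℝ) := by
  have hJ : Continuous (fun x : E => innerSL ℝ x) := (innerBilin E).continuous
  have hS : Continuous (fun x : E => (innerSL ℝ x).smulRight (innerSL ℝ x)) :=
    ((ContinuousLinearMap.smulRightL ℝ E (E →L[ℝ] ℝ)).continuous.comp hJ).clm_apply hJ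
  exact continuous_add_div_norm_sq_smul hz hw h0 (innerBilin E) hS fun x => by
    rw [ContinuousLinearMap.norm_smulRight_apply, innerSL_apply_norm, sq]

theorem fderiv_radial {v z : ℝ → ℝ} (hv : ∀ r, HasDerivAt v (r * z r) r) :
    fderiv ℝ (fun x : E => v ‖x‖) = fun x => z ‖x‖ • innerSL ℝ x :=
  funext fun x => (hasFDerivAt_radial hv x).fderiv

theorem fderiv_fderiv_radial {v z w : ℝ → ℝ} (hz : Continuous z)
    (hv : ∀ r, HasDerivAt v (r * z r) r) (hp : ∀ r, HasDerivAt (fun r => r * z r) (w r) r) :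
    fderiv ℝ (fderiv ℝ (fun x : E => v ‖x‖)) = radialHessian z w := by
  rw [fderiv_radial hv]
  exact funext fun x => (hasFDerivAt_radial_gradient hz hp x).fderiv

/-- `v'' = v' / r` at `r = 0`. -/
theorem deriv_radial_zero {z w : ℝ → ℝ} (hz : Continuous z)
    (hp : ∀ r, HasDerivAt (fun r => r * z r) (w r) r) : w 0 = z 0 :=
  (hp 0).unique (hasDerivAt_zero_mul hz.continuousAt)

theorem contDiff_radial {v z w : ℝ → ℝ} (hz : Continuous z) (hw : Continuous w)
    (hv : ∀ r, HasDerivAt v (r * z r) r) (hp : ∀ r, HasDerivAt (fun r => r * z r) (w r) r) :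
    ContDiff ℝ 2 (fun x : E => v ‖x‖) := by
  rw [show (2 : WithTop ℕ∞) = 1 + 1 by norm_num, contDiff_succ_iff_fderiv]
  refine ⟨fun x => (hasFDerivAt_radial hv x).differentiableAt, by simp, ?_⟩
  rw [contDiff_one_iff_fderiv, fderiv_fderiv_radial hz hv hp, fderiv_radial hv]
  exact ⟨fun x => (hasFDerivAt_radial_gradient hz hp x).differentiableAt,
    continuous_radialHessian hz hw (deriv_radial_zero hz hp)⟩

end

open Polynomial in
/-- A scalar matrix plus a matrix of rank one has one exceptional eigenvalue. -/
theorem roots_charpoly_scalar_add {N : ℕ} (hN : 1 ≤ N) (z : ℝ) (p q : Fin N → ℝ)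
    (A : Matrix (Fin N) (Fin N) ℝ)
    (hA : A = Matrix.scalar (Fin N) z + Matrix.vecMulVec p q) :
    A.charpoly.roots = (p ⬝ᵥ q + z) ::ₘ Multiset.replicate (N - 1) z := by
  have h1 := Matrix.charpoly_sub_scalar A z
  rw [show A - Matrix.scalar (Fin N) z = Matrix.vecMulVec p q by rw [hA]; abel,
    Matrix.charpoly_vecMulVec, Fintype.card_fin] at h1
  have h2 : A.charpoly = (X - C (p ⬝ᵥ q + z)) * (X - C z) ^ (N - 1) := by
    have h3 := congrArg (fun f : ℝ[X] => f.comp (X - C z)) h1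
    simp only [comp_assoc, add_comp, X_comp, C_comp, sub_add_cancel, comp_X, sub_comp, pow_comp,
      smul_comp] at h3
    rw [← h3, smul_eq_C_mul]
    obtain ⟨k, rfl⟩ : ∃ k, N = k + 1 := ⟨N - 1, by omega⟩
    simp only [Nat.add_sub_cancel, map_add]
    ring
  rw [h2, roots_mul (by
    rw [← h2]
    exact (Matrix.charpoly_monic A).ne_zero), roots_X_sub_C, roots_pow, roots_X_sub_C,
    Multiset.nsmul_singleton, Multiset.singleton_add]

theorem sum_map_pucciFun (a b : ℝ) (s : Multiset ℝ) :
    b * (s.filter (fun e => e < 0)).sum + a * (s.filter (fun e => 0 ≤ e)).sum =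
      (s.map (pucciFun a b)).sum := by
  induction s using Multiset.induction_on with
  | empty => simp
  | cons e s ih =>
    rw [Multiset.map_cons, Multiset.sum_cons, ← ih]
    rcases lt_or_ge e 0 with he | he
    · rw [Multiset.filter_cons_of_pos (p := (· < 0)) _ he,
        Multiset.filter_cons_of_neg (p := (0 ≤ ·)) _ (not_le.2 he),
        Multiset.sum_cons, pucciFun, max_eq_right he.le, min_eq_left he.le]
      ring
    · rw [Multiset.filter_cons_of_neg (p := (· < 0)) _ (not_lt.2 he),
        Multiset.filter_cons_of_pos (p := (0 ≤ ·)) _ he,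
        Multiset.sum_cons, pucciFun, max_eq_left he, min_eq_right he]
      ring

/-- The value on a matrix `z I + p qᵀ` with `p ⬝ q = w - z`, whose eigenvalues are `w`, once, and
`z`, `N - 1` times. -/
theorem pucciPlus_scalar_add {N : ℕ} (hN : 1 ≤ N) (a b w z : ℝ) {p q : Fin N → ℝ}
    (hpq : p ⬝ᵥ q = w - z) {A : Matrix (Fin N) (Fin N) ℝ}
    (hA : A = Matrix.scalar (Fin N) z + Matrix.vecMulVec p q) :
    pucciPlus b a A = pucciFun a b w + ((N : ℝ) - 1) * pucciFun a b z := by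
  have hcast : ((N - 1 : ℕ) : ℝ) = (N : ℝ) - 1 := by
    rw [Nat.cast_sub hN, Nat.cast_one]
  rw [pucciPlus, sum_map_pucciFun, roots_charpoly_scalar_add hN z p q A hA, hpq, sub_add_cancel,
    ← hcast, Multiset.map_cons, Multiset.sum_cons, Multiset.map_replicate, Multiset.sum_replicate,
    nsmul_eq_mul]

theorem hessian_radial {N : ℕ} {v z w : ℝ → ℝ} (hz : Continuous z)
    (hv : ∀ r, HasDerivAt v (r * z r) r) (hp : ∀ r, HasDerivAt (fun r => r * z r) (w r) r)
    (x : EuclideanSpace ℝ (Fin N)) :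
    hessian (fun x => v ‖x‖) x = Matrix.scalar (Fin N) (z ‖x‖) +
      Matrix.vecMulVec (((w ‖x‖ - z ‖x‖) / ‖x‖ ^ 2) • (x : Fin N → ℝ)) x := by
  ext i j
  rw [hessian, Matrix.of_apply, fderiv_fderiv_radial hz hv hp]
  simp [radialHessian, Matrix.vecMulVec_apply, Matrix.diagonal_apply,
    EuclideanSpace.inner_single_right, PiLp.single_apply]
  rcases eq_or_ne i j with rfl | h
  · simp
  · simp [h, h.symm]

theorem isC2Solution_radial {N : ℕ} (hN : 1 ≤ N) {a b : ℝ} {g v z w : ℝ → ℝ} (hz : Continuous z)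
    (hw : Continuous w) (hv : ∀ r, HasDerivAt v (r * z r) r)
    (hp : ∀ r, HasDerivAt (fun r => r * z r) (w r) r)
    (heq : ∀ r, 0 ≤ r →
      pucciFun a b (w r) + ((N : ℝ) - 1) * pucciFun a b (z r) + g (v r) = 0) :
    IsC2Solution (pucciPlus b a) g (fun x : EuclideanSpace ℝ (Fin N) => v ‖x‖) := by
  refine ⟨contDiff_radial hz hw hv hp, fun x => ?_⟩
  rw [pucciPlus_scalar_add hN a b (w ‖x‖) (z ‖x‖) ?_ (hessian_radial hz hv hp x)]
  · exact heq _ (norm_nonneg x)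
  · rw [smul_dotProduct, smul_eq_mul]
    have hd : (x : Fin N → ℝ) ⬝ᵥ x = ‖x‖ ^ 2 := by
      rw [EuclideanSpace.real_norm_sq_eq]
      simp [dotProduct, sq]
    rw [hd]
    rcases eq_or_ne x 0 with rfl | hx
    · simp [deriv_radial_zero hz hp]
    · have hn : ‖x‖ ≠ 0 := norm_ne_zero_iff.2 hx
      field_simp

theorem isLocalized_radial {N : ℕ} {v z w : ℝ → ℝ} (hz : Continuous z)
    (hv : ∀ r, HasDerivAt v (r * z r) r) (hp : ∀ r, HasDerivAt (fun r => r * z r) (w r) r)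
    (hv0 : Tendsto v atTop (𝓝 0)) (hp0 : Tendsto (fun r => r * z r) atTop (𝓝 0))
    (hz0 : Tendsto z atTop (𝓝 0)) (hw0 : Tendsto w atTop (𝓝 0)) :
    IsLocalized (fun x : EuclideanSpace ℝ (Fin N) => v ‖x‖) := by
  have hnorm := tendsto_norm_cocompact_atTop (E := EuclideanSpace ℝ (Fin N))
  refine ⟨hv0.comp hnorm, fun i => ?_, fun i j => ?_⟩
  · rw [fderiv_radial hv]
    have h := (hp0.comp hnorm).abs
    rw [abs_zero] at h
    refine squeeze_zero_norm (fun x => ?_) h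
    have h1 := abs_real_inner_le_norm x (EuclideanSpace.single i (1 : ℝ))
    have h2 : ‖EuclideanSpace.single i (1 : ℝ)‖ = 1 := by simp
    rw [h2, mul_one] at h1
    rw [smul_apply, innerSL_apply_apply, smul_eq_mul, norm_mul,
      Real.norm_eq_abs, Real.norm_eq_abs, Function.comp_apply, abs_mul, abs_norm, mul_comm]
    exact mul_le_mul_of_nonneg_right h1 (abs_nonneg _)
  · have h := (hz0.abs.add (hw0.sub hz0).abs).comp hnorm
    simp only [abs_zero, sub_zero, add_zero] at h
    refine squeeze_zero_norm (fun x => ?_) h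
    rw [hessian, Matrix.of_apply, fderiv_fderiv_radial hz hv hp]
    have h1 := abs_radialHessian_apply_le z w x (EuclideanSpace.single i (1 : ℝ))
      (EuclideanSpace.single j (1 : ℝ))
    simpa using h1

/-! ### Oscillation and decay of the radial profiles -/

/-- A damping term of size `v' / r` does not stop the rotation of `(v, v')` for large `r`. -/
theorem exists_zero_ge_of_damping {f : ℝ → ℝ} {κ C : ℝ} (hκ : 0 < κ)
    (hfκ : ∀ x, κ * x ^ 2 ≤ x * f x) {v p D : ℝ → ℝ} (hv : ∀ r, HasDerivAt v (p r) r)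
    (hp : ∀ r, HasDerivAt p (-(f (v r) + D r)) r)
    (hDC : ∀ r, 0 < r → r * |D r| ≤ C * |p r|) (R' : ℝ) : ∃ r, R' ≤ r ∧ v r = 0 := by
  set m := min κ 1 / 2 with hm
  have hm0 : 0 < m := by positivity
  refine exists_zero_ge (h := fun r => f (v r) + D r) (R := 1 + |C| / m) hv hp hm0
    (fun r hr => ?_) R'
  have hq : 0 ≤ |C| / m := by positivity
  have h0 : 0 < r := by linarith
  have hCr : |C| ≤ m * r := by
    rw [← div_le_iff₀' hm0]
    linarith
  have h1 : 2 * (|v r| * |p r|) ≤ v r ^ 2 + p r ^ 2 := by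
    rw [← sq_abs (v r), ← sq_abs (p r)]
    nlinarith [sq_nonneg (|v r| - |p r|)]
  have h2 : |v r * D r| ≤ m * (v r ^ 2 + p r ^ 2) := by
    rw [abs_mul]
    refine le_of_mul_le_mul_left ?_ h0
    have e1 := mul_le_mul_of_nonneg_left (hDC r h0) (abs_nonneg (v r))
    have e2 := mul_le_mul_of_nonneg_right ((le_abs_self C).trans hCr)
      (mul_nonneg (abs_nonneg (v r)) (abs_nonneg (p r)))
    have e3 := mul_le_mul_of_nonneg_left h1 (mul_pos hm0 h0).le
    have e4 : 0 ≤ m * r * (|v r| * |p r|) := by positivity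
    linarith
  have h3 := neg_abs_le (v r * D r)
  have h4 := hfκ (v r)
  have h5 : 2 * m ≤ κ := by
    rw [hm]
    linarith [min_le_left κ 1]
  have h6 : 2 * m ≤ 1 := by
    rw [hm]
    linarith [min_le_right κ 1]
  have h7 := mul_le_mul_of_nonneg_right h5 (sq_nonneg (v r))
  have h8 := mul_le_mul_of_nonneg_right h6 (sq_nonneg (p r))
  linarith

section

variable {a b m : ℝ} {G : ℝ → ℝ}

theorem radialForce_damping (ha : 0 < a) (hb : 0 < b) (hm : 0 ≤ m) (x z : ℝ) :
    (max a b)⁻¹ * (m * min a b) * z ^ 2 ≤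
        z * (radialForce a b m G x z - radialForce a b m G x 0) ∧
      |radialForce a b m G x z - radialForce a b m G x 0| ≤
        (min a b)⁻¹ * (m * max a b) * |z| := by
  have hl : 0 < min a b := lt_min ha hb
  have hu : 0 < max a b := hl.trans_le min_le_max
  have hc : 0 ≤ (max a b)⁻¹ * (m * min a b) := by positivity
  rcases le_total 0 z with h | h
  · have h1 := radialForce_sub_bounds (G := G) hl (min_le_left a b) (min_le_right a b)
      (le_max_left a b) (le_max_right a b) hm x h
    rw [sub_zero] at h1
    have h2 := mul_le_mul_of_nonneg_left h1.1 h
    have h3 := mul_nonneg hc h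
    rw [abs_of_nonneg h, abs_of_nonneg (h3.trans h1.1)]
    exact ⟨by linarith, h1.2⟩
  · have h1 := radialForce_sub_bounds (G := G) hl (min_le_left a b) (min_le_right a b)
      (le_max_left a b) (le_max_right a b) hm x h
    rw [zero_sub] at h1
    have h2 := mul_le_mul_of_nonneg_left h1.1 (neg_nonneg.2 h)
    have h3 := mul_nonneg hc (neg_nonneg.2 h)
    rw [abs_of_nonpos h, abs_sub_comm, abs_of_nonneg (h3.trans h1.1)]
    exact ⟨by linarith, h1.2⟩

/-- The radial initial value problem for a globally Lipschitz nonlinearity; the number `n` of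
`exists_radial_profile` is taken above the slope of `radialForce` in `z`. -/
theorem exists_pucci_profile {K : NNReal} (ha : 0 < a) (hb : 0 < b) (hm : 0 ≤ m)
    (hG : LipschitzWith K G) (v₀ : ℝ) :
    ∃ v z : ℝ → ℝ, Continuous z ∧ v 0 = v₀ ∧ (∀ r, HasDerivAt v (r * z r) r) ∧
      ∀ r, HasDerivAt (fun r => r * z r) (-radialForce a b m G (v r) (z r)) r := by
  have hl : 0 < min a b := lt_min ha hb
  have hu : 0 < max a b := hl.trans_le min_le_max
  obtain ⟨n, hn⟩ := exists_nat_ge ((min a b)⁻¹ * (m * max a b))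
  have hslope : ∀ x z z', |n * (z - z') - (radialForce a b m G x z - radialForce a b m G x z')| ≤
      n * |z - z'| := by
    intro x z z'
    wlog h : z' ≤ z generalizing z z'
    · have := this z' z (le_of_not_ge h)
      rw [abs_sub_comm z, ← abs_neg]
      refine le_trans (le_of_eq ?_) this
      congr 1
      ring
    have h1 := radialForce_sub_bounds (G := G) hl (min_le_left a b) (min_le_right a b)
      (le_max_left a b) (le_max_right a b) hm x h
    have hd : 0 ≤ z - z' := sub_nonneg.2 h
    have h2 := mul_le_mul_of_nonneg_right hn hd
    have h3 : 0 ≤ (max a b)⁻¹ * (m * min a b) * (z - z') := by positivity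
    rw [abs_of_nonneg hd, abs_of_nonneg (by linarith)]
    linarith
  obtain ⟨v, z, hz, h0, hv, hp⟩ := exists_radial_profile n
    (H := fun x z => n * z - radialForce a b m G x z) (L := (min a b)⁻¹ * K)
    (by positivity) (fun x z x' z' => by
      have h1 := abs_radialForce_sub_le (m := m) hG hl (min_le_left a b) (min_le_right a b) x' x z
      have h2 := hslope x' z z'
      rw [abs_sub_comm x' x] at h1
      refine le_trans ?_ (add_le_add h1 h2)
      refine le_trans (le_of_eq ?_) (abs_add_le _ _)
      congr 1
      ring) v₀
  exact ⟨v, z, hz, h0, hv, fun r => (hp r).congr_deriv (by ring)⟩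

end

theorem tendsto_zero_of_tendsto_sq_add_sq {v p : ℝ → ℝ} {l : Filter ℝ}
    (h : Tendsto (fun r => v r ^ 2 + p r ^ 2) l (𝓝 0)) :
    Tendsto v l (𝓝 0) ∧ Tendsto p l (𝓝 0) := by
  have hs := h.sqrt
  rw [Real.sqrt_zero] at hs
  exact ⟨squeeze_zero_norm (fun r => Real.abs_le_sqrt (by linarith [sq_nonneg (p r)])) hs,
    squeeze_zero_norm (fun r => Real.abs_le_sqrt (by linarith [sq_nonneg (v r)])) hs⟩

/-- For `m > 0`, that is `N ≥ 2`, the term in `v' / r` damps the equation: the profile oscillates,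
and it tends to zero together with its derivatives. -/
theorem tendsto_zero_profile {a b m κ : ℝ} (ha : 0 < a) (hb : 0 < b) (hm : 0 < m) (hκ : 0 < κ)
    {G : ℝ → ℝ} {K : NNReal} (hG : LipschitzWith K G) (hG0 : G 0 = 0)
    (hGκ : ∀ x, κ * x ^ 2 ≤ x * radialForce a b m G x 0) {v z : ℝ → ℝ}
    (hv : ∀ r, HasDerivAt v (r * z r) r)
    (hp : ∀ r, HasDerivAt (fun r => r * z r) (-radialForce a b m G (v r) (z r)) r) :
    (∀ R, ∃ r, R ≤ r ∧ v r = 0) ∧ Tendsto v atTop (𝓝 0) ∧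
      Tendsto (fun r => r * z r) atTop (𝓝 0) ∧ Tendsto z atTop (𝓝 0) ∧
      Tendsto (fun r => -radialForce a b m G (v r) (z r)) atTop (𝓝 0) := by
  have hl : 0 < min a b := lt_min ha hb
  have hu : 0 < max a b := hl.trans_le min_le_max
  have hc : 0 < (max a b)⁻¹ * (m * min a b) := by positivity
  have hp' : ∀ r, HasDerivAt (fun r => r * z r) (-(radialForce a b m G (v r) 0 +
      (radialForce a b m G (v r) (z r) - radialForce a b m G (v r) 0))) r := fun r =>
    (hp r).congr_deriv (by ring)
  have hDC : ∀ r, 0 < r → r * |radialForce a b m G (v r) (z r) - radialForce a b m G (v r) 0| ≤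
      (min a b)⁻¹ * (m * max a b) * |r * z r| := fun r hr => by
    have := mul_le_mul_of_nonneg_left (radialForce_damping (G := G) ha hb hm.le (v r) (z r)).2 hr.le
    rw [abs_mul, abs_of_pos hr]
    linarith
  have hF00 : radialForce a b m G 0 0 = 0 := by
    rw [radialForce_zero_right, hG0, pucciFun_zero]
  have hlim := tendsto_zero_of_tendsto_sq_add_sq (tendsto_zero_of_damping
    (continuous_radialForce a b m hG.continuous continuous_id continuous_const) hκ hc hGκ
    (L := (min a b)⁻¹ * K) (fun x => by
      have h1 := abs_radialForce_sub_le (m := m) hG hl (min_le_left a b) (min_le_right a b) x 0 0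
      rw [hF00, sub_zero, sub_zero] at h1
      have h2 := mul_le_mul_of_nonneg_left h1 (abs_nonneg x)
      rw [← abs_mul] at h2
      have h3 := le_abs_self (x * radialForce a b m G x 0)
      have h4 := abs_mul_abs_self x
      calc _ ≤ _ := h3.trans h2
        _ = (min a b)⁻¹ * K * (|x| * |x|) := by ring
        _ = _ := by rw [h4, sq])
    hv hp' (fun r hr => by
      have := mul_le_mul_of_nonneg_left
        (radialForce_damping (G := G) ha hb hm.le (v r) (z r)).1 (sq_nonneg r)
      linarith) hDC)
  have hz : Tendsto z atTop (𝓝 0) := by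
    refine squeeze_zero_norm' ?_ (by simpa using hlim.2.abs)
    filter_upwards [eventually_ge_atTop 1] with r hr
    simp only [Real.norm_eq_abs]
    exact le_mul_of_one_le_left (abs_nonneg _) (hr.trans (le_abs_self r))
  refine ⟨exists_zero_ge_of_damping (f := fun x => radialForce a b m G x 0) hκ hGκ hv hp' hDC,
    hlim.1, hlim.2, hz, ?_⟩
  have hcont : Continuous fun q : ℝ × ℝ => radialForce a b m G q.1 q.2 := by
    have h1 := continuous_pucciFun a b
    have h2 := continuous_pucciFun b⁻¹ a⁻¹
    have h3 := hG.continuous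
    unfold radialForce
    fun_prop
  have := ((hcont.tendsto (0, 0)).comp (hlim.1.prodMk_nhds hz)).neg
  rwa [hF00, neg_zero] at this

/-! ### Infinitely many solutions -/

theorem isOscillating_radial {N : ℕ} (hN : 1 ≤ N) {v : ℝ → ℝ}
    (h : ∀ R, ∃ r, R ≤ r ∧ v r = 0) :
    IsOscillating (fun x : EuclideanSpace ℝ (Fin N) => v ‖x‖) := by
  choose ρ hρ hv using fun n : ℕ => h n
  have hnorm : ∀ n, ‖EuclideanSpace.single (⟨0, hN⟩ : Fin N) (ρ n)‖ = ρ n := fun n => by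
    have : 0 ≤ ρ n := (Nat.cast_nonneg n).trans (hρ n)
    simp [abs_of_nonneg this]
  refine ⟨fun n => EuclideanSpace.single ⟨0, hN⟩ (ρ n), fun n => ?_, fun hb => ?_⟩
  · simp only [hnorm, hv]
  · obtain ⟨C, hC⟩ := hb.exists_norm_le
    obtain ⟨n, hn⟩ := exists_nat_gt C
    have := hC _ (Set.mem_range_self n)
    simp only [hnorm] at this
    linarith [hρ n]

theorem isPeriodic_radial_one {v : ℝ → ℝ} (heven : ∀ r, v (-r) = v r)
    (hper : ∃ T, T ≠ 0 ∧ ∀ r, v (r + T) = v r) :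
    IsPeriodic (fun x : EuclideanSpace ℝ (Fin 1) => v ‖x‖) := by
  obtain ⟨T, hT, hvT⟩ := hper
  have habs : ∀ x : EuclideanSpace ℝ (Fin 1), v ‖x‖ = v (x 0) := fun x => by
    rw [EuclideanSpace.norm_eq, Fin.sum_univ_one, Real.norm_eq_abs, sq_abs, Real.sqrt_sq_eq_abs]
    rcases abs_choice (x 0) with h | h
    · rw [h]
    · rw [h, heven]
  refine ⟨EuclideanSpace.single 0 T, by simpa using hT, fun x => ?_⟩
  simp only [habs]
  simpa using hvT (x 0)

/-- The case `b = λ`, `a = Λ` is `M⁺`, the case `b = Λ`, `a = λ` is `M⁻`; the proof does not compare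
`a` with `b`. -/
theorem infinite_solutions {N : ℕ} (hN : 1 ≤ N) {a b : ℝ} (ha : 0 < a) (hb : 0 < b)
    {g : ℝ → ℝ} (hg1 : LocallyLipschitz g) (hg2 : ∀ t, g (-t) = -g t) (hg3 : SignCondition g)
    (hg4 : 2 ≤ N → DifferentiableAt ℝ g 0 ∧ 0 < deriv g 0) :
    {u : EuclideanSpace ℝ (Fin N) → ℝ |
        IsC2Solution (pucciPlus b a) g u ∧ IsOscillating u ∧ IsRadial u ∧
        (N = 1 → IsPeriodic u) ∧ (2 ≤ N → IsLocalized u)}.Infinite := by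
  have hl : 0 < min a b := lt_min ha hb
  have hu : 0 < max a b := hl.trans_le min_le_max
  have hg0 : g 0 = 0 := by
    have := hg2 0
    rw [neg_zero] at this
    linarith
  set m : ℝ := (N : ℝ) - 1 with hm
  have hN' : (1 : ℝ) ≤ N := by exact_mod_cast hN
  have hm0 : 0 ≤ m := by linarith
  obtain ⟨M₁, hM₁, hpos₁⟩ := exists_pos_mul_pos hg2 hg3
  obtain ⟨M, hM, hMM₁, κ, hκN⟩ : ∃ M, 0 < M ∧ M ≤ M₁ ∧ ∃ κ : ℝ, 2 ≤ N →
      0 < κ ∧ κ ≤ 1 ∧ ∀ x, |x| ≤ M → κ * x ^ 2 ≤ x * g x := by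
    by_cases h2 : 2 ≤ N
    · obtain ⟨κ, M₂, h1, h2, h3, h4⟩ := exists_coercive hg0 (hg4 h2).1 (hg4 h2).2
      exact ⟨min M₁ M₂, lt_min hM₁ h3, min_le_left _ _, κ, fun _ =>
        ⟨h1, h2, fun x hx => h4 x (hx.trans (min_le_right _ _))⟩⟩
    · exact ⟨M₁, hM₁, le_rfl, 0, fun h => absurd h h2⟩
  set G := linearExtension g M with hGdef
  obtain ⟨K, hK⟩ := exists_lipschitzWith_linearExtension hg1 hM.le
  have hGpos : ∀ x, x ≠ 0 → 0 < x * G x :=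
    mul_linearExtension_pos hM fun x hx hxM => hpos₁ x hx (hxM.trans hMM₁)
  have hG0 : G 0 = 0 := by
    rw [hGdef, linearExtension_of_abs_le (by simpa using hM.le), hg0]
  have hGnn : ∀ x, 0 ≤ x * G x := fun x => by
    rcases eq_or_ne x 0 with rfl | hx
    · simp
    · exact (hGpos x hx).le
  set f : ℝ → ℝ := fun x => radialForce a b m G x 0 with hf
  have hfle : ∀ x, (max a b)⁻¹ * (x * G x) ≤ x * f x := fun x =>
    le_mul_radialForce_zero hl (min_le_left a b) (min_le_right a b) (le_max_left a b)
      (le_max_right a b) (hGnn x)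
  have hfpos : ∀ x, x ≠ 0 → 0 < x * f x := fun x hx =>
    (mul_pos (inv_pos.2 hu) (hGpos x hx)).trans_le (hfle x)
  have hfc : Continuous f :=
    continuous_radialForce a b m hK.continuous continuous_id continuous_const
  -- Small initial values: the energy confines the solution to the range where `G = g`.
  have hsmall : ∀ᶠ v₀ in 𝓝 (0 : ℝ),
      potential f v₀ < potential f M ∧ potential f v₀ < potential f (-M) := by
    have ht := (continuous_potential hfc).tendsto 0
    rw [potential_zero] at ht
    exact (ht.eventually (gt_mem_nhds (potential_pos hfc hfpos hM.ne'))).and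
      (ht.eventually (gt_mem_nhds (potential_pos hfc hfpos (neg_ne_zero.2 hM.ne'))))
  obtain ⟨δ, hδ, hball⟩ := Metric.eventually_nhds_iff.1 hsmall
  refine Set.Infinite.of_image (fun u => u 0) ((Set.Ioo_infinite hδ).mono fun v₀ hv₀ => ?_)
  obtain ⟨hlt1, hlt2⟩ := hball (y := v₀) (by
    rw [Real.dist_eq, sub_zero, abs_of_pos hv₀.1]
    exact hv₀.2)
  obtain ⟨v, z, hz, h0, hv, hp⟩ := exists_pucci_profile ha hb hm0 hK v₀
  have hbound : ∀ r, 0 ≤ r → |v r| < M := fun r hr => by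
    have hE := energy_le (F := radialForce a b m G) hfc (fun x z =>
      le_trans (by positivity) (radialForce_damping ha hb hm0 x z).1) hv hp hr
    have hE' : potential f (v r) ≤ potential f v₀ := by
      rw [h0] at hE
      linarith [sq_nonneg (r * z r)]
    exact abs_lt_of_potential_lt hfc hfpos hM (hE'.trans_lt hlt1) (hE'.trans_lt hlt2)
  have hvc : Continuous v := continuous_iff_continuousAt.2 fun r => (hv r).continuousAt
  have hsol : IsC2Solution (pucciPlus b a) g (fun x : EuclideanSpace ℝ (Fin N) => v ‖x‖) :=
    isC2Solution_radial hN hz (continuous_radialForce a b m hK.continuous hvc hz).neg hv hp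
      fun r hr => by
        rw [← linearExtension_of_abs_le (g := g) (hbound r hr).le]
        exact pucciFun_radialForce ha hb m G (v r) (z r)
  have hrad : IsRadial (fun x : EuclideanSpace ℝ (Fin N) => v ‖x‖) := fun x y h => by
    simp only [h]
  refine ⟨fun x => v ‖x‖, ?_, by simpa using h0⟩
  rcases hN.eq_or_lt with rfl | h2
  · have hF : ∀ x z, radialForce a b m G x z = f x := fun x z => by
      simp [hf, hm, radialForce]
    have hflip : LipschitzWith (Real.toNNReal ((min a b)⁻¹ * K)) f :=
      LipschitzWith.of_dist_le' fun x y =>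
        abs_radialForce_sub_le hK hl (min_le_left a b) (min_le_right a b) x y 0
    obtain ⟨heven, hper, hosc⟩ := even_periodic_oscillating hflip hfpos hv
      (fun r => (hp r).congr_deriv (by rw [hF])) (zero_mul _) (by rw [h0]; exact hv₀.1.ne')
      (fun r hr => (hbound r hr).le)
    exact ⟨hsol, isOscillating_radial le_rfl hosc, hrad,
      fun _ => isPeriodic_radial_one heven hper, fun h => absurd h (by norm_num)⟩
  · obtain ⟨hκ0, hκ1, hκ⟩ := hκN h2
    have hm1 : 0 < m := by
      have : (1 : ℝ) < N := by exact_mod_cast h2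
      linarith
    obtain ⟨hosc, hv0, hp0, hz0, hw0⟩ := tendsto_zero_profile ha hb hm1
      (mul_pos (inv_pos.2 hu) hκ0) hK hG0 (fun x => by
        refine le_trans ?_ (hfle x)
        rw [mul_assoc]
        exact mul_le_mul_of_nonneg_left (le_mul_linearExtension hM hκ1 hκ x) (inv_pos.2 hu).le)
      hv hp
    exact ⟨hsol, isOscillating_radial hN hosc, hrad, fun h => absurd h (by omega),
      fun _ => isLocalized_radial hz hv hp hv0 hp0 hz0 hw0⟩

end Pucci

theorem theorem1p1 (N : ℕ) (hN : 1 ≤ N) (lam Lam : ℝ) (hlam : 0 < lam) (hLam : lam ≤ Lam)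
    (g : ℝ → ℝ) (hg1 : LocallyLipschitz g) (hg2 : ∀ t, g (-t) = -g t)
    (hg3 : Pucci.SignCondition g)
    (hg4 : 2 ≤ N → DifferentiableAt ℝ g 0 ∧ 0 < deriv g 0) :
    {u : EuclideanSpace ℝ (Fin N) → ℝ |
        Pucci.IsC2Solution (Pucci.pucciPlus lam Lam) g u ∧ Pucci.IsOscillating u ∧
        Pucci.IsRadial u ∧ (N = 1 → Pucci.IsPeriodic u) ∧
        (2 ≤ N → Pucci.IsLocalized u)}.Infinite ∧
    {u : EuclideanSpace ℝ (Fin N) → ℝ |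
        Pucci.IsC2Solution (Pucci.pucciMinus lam Lam) g u ∧ Pucci.IsOscillating u ∧
        Pucci.IsRadial u ∧ (N = 1 → Pucci.IsPeriodic u) ∧
        (2 ≤ N → Pucci.IsLocalized u)}.Infinite := by
  have hLam0 : 0 < Lam := hlam.trans_le hLam
  -- `pucciMinus lam Lam` is by definition `pucciPlus Lam lam`.
  exact ⟨Pucci.infinite_solutions hN hLam0 hlam hg1 hg2 hg3 hg4,
    Pucci.infinite_solutions hN hlam hLam0 hg1 hg2 hg3 hg4⟩
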